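/- **Topological recursion.** Let a curve with a global coordinate $z$ be given, together with functions $x,y$ on it ($y$ may be multivalued), a finite set $\mathcal P$ of simple critical points of $x$ at which $dy\ne 0$, and a symmetric bidifferential $B(z_1,z_2)$. Near $\xi\in\mathcal P$ let $\sigma_\xi$ be the non-trivial local holomorphic involution with $x\circ\sigma_\xi=x$, and use there one holomorphic branch of $y$. Put $\omega_{0,2}=B$ and, for $g\ge 0$, $n\ge1$, $2g-2+n>0$, $$\omega_{g,n}(z_1,\dots,z_n)=\frac12\sum_{\xi\in\mathcal P}\operatorname*{Res}_{z\to\xi}\frac{\int_z^{\sigma_\xi(z)}B(z_1,\cdot)}{\bigl(y(\sigma_\xi(z))-y(z)\bigr)\,dx(z)}\Bigl(\omega_{g-1,n+1}(z,\sigma_\xi(z),z_2,\dots,z_n)+\sum_{\substack{g_1+g_2=g,\ I_1\sqcup I_2=\{2,\dots,n\}\\ (g_1,|I_1|),(g_2,|I_2|)\neq(0,0)}}\omega_{g_1,1+|I_1|}(z,z_{I_1})\,\omega_{g_2,1+|I_2|}(\sigma_\xi(z),z_{I_2})\Bigr),$$ where $\int_z^{\sigma_\xi(z)}$ is taken along a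 path near $\xi$ and $\omega_{-1,n+1}=0$. For ordinary topological recursion $\omega_{0,1}=y\,dx$; for $G$-equivariant topological recursion ($G$ a finite group acting on the curve, with $dx$, $dy$, $B$ equivariant under characters of $G$ and $B$ having the singular part of $\sum_{\eta\in G}\beta_\eta^{-1}\frac{d(\eta z_1)\,dz_2}{(\eta z_1-z_2)^2}$, where $\beta$ is the character of $B$) the same recursion is used and $\omega_{0,1}=|G|^{-1}y\,dx$. **Proposition.** Let $\epsilon\in\mathbb C\setminus\{0\}$ and fix square roots $\sqrt{\epsilon/2}$ and $\sqrt{2\epsilon}$ (any choice). Let $\tilde\omega_{g,n}$ be the differentials of topological recursion on the rational curve with coordinate $w$, $$\tilde x=\frac{w^2}{2},\qquad \tilde y=\frac{2\,\mathrm{arcsinh}(w/\sqrt{2\epsilon})}{\sqrt{w^2+2\epsilon}},\qquad \tilde B=\frac{dw_1\,dw_2}{(w_1-w_2)^2},\qquad \mathcal P=\{0\},$$ where near $w=0$ the branches are those with $\mathrm{arcsinh}(0)=0$ and $\sqrt{w^2+2\epsilon}\,|_{w=0}=\sqrt{2\epsilon}$. Let $\omega_{g,n}$ be the differentials of $\mathbb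 Z_2$-equivariant topological recursion on the rational curve with coordinate $z$, $\mathbb Z_2$ acting by $\iota(z)=-1/z$, $$x=\sqrt{\epsilon/2}\,\Bigl(z+\frac1z\Bigr),\qquad y=2\log z,\qquad B=\frac{dz_1\,dz_2}{(z_1-z_2)^2}+\frac{d\iota(z_1)\,dz_2}{(\iota(z_1)-z_2)^2},\qquad \mathcal P=\{1,-1\}.$$ Then for all $g\ge0$, $n\ge1$ with $2g-2+n\ge0$, the pull-back under $w_i=\sqrt{\epsilon/2}\,(z_i-z_i^{-1})$, $i=1,\dots,n$, satisfies $$2^{2g-2+n}\,\tilde\omega_{g,n}(w_1,\dots,w_n)\Big|_{w_i=\sqrt{\epsilon/2}\,(z_i-z_i^{-1})}=\omega_{g,n}(z_1,\dots,z_n)$$ at all $z_i\in\mathbb C\setminus\{0\}$ away from the poles, i.e. for $z_i\ne\pm1$ if $2g-2+n>0$, and for $z_1\ne z_2$, $z_1z_2\ne-1$ if $(g,n)=(0,2)$. For $(g,n)=(0,1)$ the same identity, $\tfrac12\tilde y\,d\tilde x=\tfrac12\,y\,dx$, holds near $w=0$, $z=1$, with the branch of $\log z$ that vanishes at $z=1$.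 -/

import Mathlib

open scoped Topology

noncomputable section

namespace TopRec

/-- The residue at `ξ` of the one-form `f(z) dz`: the value of `(2πi)⁻¹ ∮_{|z-ξ|=r} f(z) dz` for small `r > 0`
(for an isolated singularity this is eventually constant in `r`). -/
def residue (f : ℂ → ℂ) (ξ : ℂ) : ℂ :=
  Filter.limUnder (𝓝[>] (0 : ℝ)) fun r : ℝ => (2 * Real.pi * Complex.I)⁻¹ * ∮ z in C(ξ, r), f z

/-- `∫_a^b f(t) dt` along the straight segment from `a` to `b`. -/
def segmentIntegral (f : ℂ → ℂ) (a b : ℂ) : ℂ :=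
  ∫ t in (0 : ℝ)..1, f (a + t * (b - a)) * (b - a)

/-- Input data of the recursion, on a Riemann surface that is an open subset `carrier` of the
affine line with its coordinate `z`. Differentials are recorded by their coefficients:
`dx = deriv x z dz`, and `B z₁ z₂` stands for the bidifferential `B z₁ z₂ dz₁ dz₂`.
As `y` may be multivalued, `y ξ` is a branch of it near the point `ξ ∈ ram`;
`σ ξ` is the deck transformation of `x` near `ξ`. -/
structure RecursionData where
  carrier : Set ℂ
  isOpen_carrier : IsOpen carrier
  ram : Finset ℂ
  ram_subset : ↑ram ⊆ carrier
  x : ℂ → ℂ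
  y : ℂ → ℂ → ℂ
  σ : ℂ → ℂ → ℂ
  B : ℂ → ℂ → ℂ
  x_holo : DifferentiableOn ℂ x carrier
  x_crit : ∀ ξ ∈ ram, deriv x ξ = 0
  x_simple : ∀ ξ ∈ ram, deriv (deriv x) ξ ≠ 0
  y_analytic : ∀ ξ ∈ ram, AnalyticAt ℂ (y ξ) ξ
  dy_ne_zero : ∀ ξ ∈ ram, deriv (y ξ) ξ ≠ 0
  σ_analytic : ∀ ξ ∈ ram, AnalyticAt ℂ (σ ξ) ξ
  σ_fix : ∀ ξ ∈ ram, σ ξ ξ = ξ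
  σ_invol : ∀ ξ ∈ ram, ∀ᶠ z in 𝓝 ξ, σ ξ (σ ξ z) = z
  σ_deck : ∀ ξ ∈ ram, ∀ᶠ z in 𝓝 ξ, x (σ ξ z) = x z
  σ_ne_id : ∀ ξ ∈ ram, ∀ᶠ z in 𝓝[≠] ξ, σ ξ z ≠ z
  B_symm : ∀ z₁ ∈ carrier, ∀ z₂ ∈ carrier, B z₁ z₂ = B z₂ z₁

/-- The recursion kernel at `ξ`,
`∫_z^{σ(z)} B(z₁, ·) / ((y(σ(z)) - y(z)) dx(z))`, as a coefficient of `dz₁ / dz`. -/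
def RecursionData.kernel (D : RecursionData) (ξ z₁ z : ℂ) : ℂ :=
  segmentIntegral (D.B z₁) z (D.σ ξ z) / ((D.y ξ (D.σ ξ z) - D.y ξ z) * deriv D.x z)

/-- `D.omegaAux g m z₁ (z₂, …, z_{m+1})` is the coefficient of `dz₁ ⋯ dz_{m+1}` in the differential
`ω_{g,m+1}` of the topological recursion, `2g - 2 + (m + 1) ≥ 0`. In the sum over splittings
`g = p.1 + (g - p.1)` and `{2, …, m+1} = p.2 ⊔ p.2ᶜ` the two terms that contain `ω_{0,1}` are omitted.
The factor `deriv (D.σ ξ) z` comes from the argument `σ(z)` of a differential: `dσ(z) = σ'(z) dz`.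
The multivalued `ω_{0,1}` never enters and is defined separately; here its place is filled by `0`. -/
def RecursionData.omegaAux (D : RecursionData) (g m : ℕ) (z₁ : ℂ) (zs : Fin m → ℂ) : ℂ :=
  if g = 0 ∧ m = 0 then 0
  else if h02 : g = 0 ∧ m = 1 then D.B z₁ (zs ⟨0, by omega⟩)
  else (1 / 2) * ∑ ξ ∈ D.ram, residue (fun z =>
    D.kernel ξ z₁ z * deriv (D.σ ξ) z *
      ((if 0 < g then
          D.omegaAux (g - 1) (m + 1) z (Fin.cons (D.σ ξ z) zs) else 0) +
        ∑ p : Fin (g + 1) × Finset (Fin m),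
          if (p.1.val = 0 ∧ p.2.card = 0) ∨ (g - p.1.val = 0 ∧ (p.2ᶜ).card = 0) then 0
          else
            D.omegaAux p.1.val p.2.card z (fun j => zs (p.2.orderEmbOfFin rfl j)) *
              D.omegaAux (g - p.1.val) (p.2ᶜ).card (D.σ ξ z)
                (fun j => zs ((p.2ᶜ).orderEmbOfFin rfl j)))) ξ
termination_by 2 * g + m
decreasing_by
  · omega
  · have h1 := p.1.isLt
    have h2 := Finset.card_add_card_compl p.2
    simp only [Fintype.card_fin] at h2
    omega
  · have h1 := p.1.isLt
    have h2 := Finset.card_add_card_compl p.2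
    simp only [Fintype.card_fin] at h2
    omega

/-- The coefficient of `dz₁ ⋯ dz_n`, `n ≥ 1`, `2g - 2 + n ≥ 0`, in `ω_{g,n}`. -/
def RecursionData.omega (D : RecursionData) (g : ℕ) : (n : ℕ) → (Fin n → ℂ) → ℂ
  | 0, _ => 0
  | m + 1, z => D.omegaAux g m (z 0) (Fin.tail z)

/-- Spectral curve data: `B` has a double pole with biresidue `1` on the diagonal and no other poles. -/
structure SpectralCurve extends RecursionData where
  B_regular : ∀ z₁ ∈ carrier, ∀ z₂ ∈ carrier, z₁ ≠ z₂ →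
    AnalyticAt ℂ (fun p : ℂ × ℂ => B p.1 p.2) (z₁, z₂)
  B_diag : ∀ z ∈ carrier, ∃ h : ℂ × ℂ → ℂ, AnalyticAt ℂ h (z, z) ∧
    ∀ᶠ p in 𝓝 (z, z), p.1 ≠ p.2 → B p.1 p.2 = 1 / (p.1 - p.2) ^ 2 + h p

/-- `ω_{0,1} = y dx`, in the branch near the ramification point `ξ`. -/
def SpectralCurve.omega01 (D : SpectralCurve) (ξ z : ℂ) : ℂ :=
  D.y ξ z * deriv D.x z

/-- `G`-equivariant spectral curve data: a free holomorphic action `φ` of a finite group on the curve,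
with `dx`, `dy`, `B` equivariant under the characters `χ`, `υ`, `β`, and `B` with the same
singular part as `∑_η β_η⁻¹ d(η z₁) dz₂ / (η z₁ - z₂)²`.  The points of `ram` are all the zeros of `dx`;
`dy` is (the coefficient of) the single-valued differential of the multivalued `y`. -/
structure EquivariantSpectralCurve (G : Type) [Group G] [Fintype G] extends RecursionData where
  φ : G → ℂ → ℂ
  dy : ℂ → ℂ
  χ : G →* ℂˣ
  υ : G →* ℂˣ
  β : G →* ℂˣ
  φ_mapsTo : ∀ γ, Set.MapsTo (φ γ) carrier carrier
  φ_holo : ∀ γ, DifferentiableOn ℂ (φ γ) carrier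
  φ_one : ∀ z ∈ carrier, φ 1 z = z
  φ_mul : ∀ γ η, ∀ z ∈ carrier, φ (γ * η) z = φ γ (φ η z)
  φ_free : ∀ γ, ∀ z ∈ carrier, φ γ z = z → γ = 1
  x_crit_all : ∀ z ∈ carrier, deriv x z = 0 → z ∈ ram
  dy_mero : ∀ z ∈ carrier, MeromorphicAt dy z
  dy_spec : ∀ ξ ∈ ram, ∀ᶠ z in 𝓝 ξ, HasDerivAt (y ξ) (dy z) z
  dx_equiv : ∀ γ, ∀ z ∈ carrier, deriv x (φ γ z) * deriv (φ γ) z = χ γ * deriv x z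
  dy_equiv : ∀ γ, ∀ z ∈ carrier, dy (φ γ z) * deriv (φ γ) z = υ γ * dy z
  B_equiv : ∀ γ, ∀ z₁ ∈ carrier, ∀ z₂ ∈ carrier,
    B (φ γ z₁) z₂ * deriv (φ γ) z₁ = β γ * B z₁ z₂
  B_regular : ∀ z₁ ∈ carrier, ∀ z₂ ∈ carrier, (∀ γ, φ γ z₁ ≠ z₂) →
    AnalyticAt ℂ (fun p : ℂ × ℂ => B p.1 p.2) (z₁, z₂)
  B_orbit : ∀ γ, ∀ z ∈ carrier, ∃ h : ℂ × ℂ → ℂ, AnalyticAt ℂ h (φ γ z, z) ∧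
    ∀ᶠ p in 𝓝 (φ γ z, z), (∀ η, φ η p.1 ≠ p.2) →
      B p.1 p.2 =
        (∑ η : G, ((β η)⁻¹ : ℂˣ) * (deriv (φ η) p.1 / (φ η p.1 - p.2) ^ 2)) + h p

/-- `ω_{0,1} = |G|⁻¹ y dx`, in the branch near the ramification point `ξ`. -/
def EquivariantSpectralCurve.omega01 {G : Type} [Group G] [Fintype G]
    (D : EquivariantSpectralCurve G) (ξ z : ℂ) : ℂ :=
  (Fintype.card G : ℂ)⁻¹ * (D.y ξ z * deriv D.x z)

/-- The branch of the square root with value `1` at `1`. -/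
def csqrt (u : ℂ) : ℂ := u ^ (1 / 2 : ℂ)

/-- `arcsinh u = log (u + √(1 + u²))`, the branch with value `0` at `0`. -/
def arcsinh (u : ℂ) : ℂ := Complex.log (u + csqrt (1 + u ^ 2))

/-- `2 arcsinh(w / √(2ε)) / √(w² + 2ε)` near `w = 0`, where `r = √(2ε)` and
`√(w² + 2ε) = r √(1 + (w/r)²)` is the branch with value `r` at `w = 0`. -/
def yKN (r w : ℂ) : ℂ := 2 * arcsinh (w / r) / (r * csqrt (1 + (w / r) ^ 2))

lemma csqrt_one : csqrt 1 = 1 := by simp [csqrt]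

lemma yKN_analyticAt (r : ℂ) (hr : r ≠ 0) : AnalyticAt ℂ (yKN r) 0 := by
  have h1 : AnalyticAt ℂ (fun w : ℂ => csqrt (1 + (w / r) ^ 2)) 0 := by
    unfold csqrt
    refine AnalyticAt.cpow (by fun_prop) analyticAt_const ?_
    simp
  have h2 : AnalyticAt ℂ (fun w : ℂ => arcsinh (w / r)) 0 := by
    unfold arcsinh
    refine AnalyticAt.clog ?_ ?_
    · exact AnalyticAt.add (by fun_prop) h1
    · simp [csqrt_one]
  unfold yKN
  refine AnalyticAt.div (analyticAt_const.mul h2) (analyticAt_const.mul h1) ?_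
  simp [csqrt_one, hr]

lemma yKN_hasDerivAt (r : ℂ) (hr : r ≠ 0) : HasDerivAt (yKN r) (2 / r ^ 2) 0 := by
  have hq : HasDerivAt (fun w : ℂ => w / r) (1 / r) 0 := (hasDerivAt_id 0).div_const r
  have h1 : HasDerivAt (fun w : ℂ => csqrt (1 + (w / r) ^ 2)) 0 0 := by
    have ha := (hq.pow 2).const_add 1
    have hb := ha.cpow_const (c := (1 / 2 : ℂ)) (by simp)
    simpa [csqrt] using hb
  have h2 : HasDerivAt (fun w : ℂ => arcsinh (w / r)) (1 / r) 0 := by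
    have ha := (hq.add h1).clog (by simp [csqrt_one])
    simpa [arcsinh, csqrt_one] using ha
  have h3 := (h2.const_mul 2).div (h1.const_mul r) (by simp [csqrt_one, hr])
  have h4 : HasDerivAt (yKN r) _ 0 := h3
  convert h4 using 1
  simp [csqrt_one, arcsinh]
  field_simp

/-- The Kazarian–Norbury spectral curve: `x = w²/2`, `y = 2 arcsinh(w/√(2ε)) / √(w²+2ε)`,
`B = dw₁ dw₂ / (w₁-w₂)²`, with its only ramification point `w = 0`, where `σ(w) = -w`.
Here `r` is a chosen square root of `2ε`. -/
def curveKN (ε r : ℂ) (hε : ε ≠ 0) (hr : r ^ 2 = 2 * ε) : SpectralCurve where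
  carrier := Set.univ
  isOpen_carrier := isOpen_univ
  ram := {0}
  ram_subset := Set.subset_univ _
  x := fun w => w ^ 2 / 2
  y := fun _ => yKN r
  σ := fun _ w => -w
  B := fun w₁ w₂ => 1 / (w₁ - w₂) ^ 2
  x_holo := by fun_prop
  x_crit := by simp
  x_simple := by
    have : deriv (fun w : ℂ => w ^ 2 / 2) = fun w => w := by
      funext w; simp
    simp [this]
  y_analytic := by
    have hr0 : r ≠ 0 := by rintro rfl; simp at hr; exact hε hr
    simpa using yKN_analyticAt r hr0
  dy_ne_zero := by
    have hr0 : r ≠ 0 := by rintro rfl; simp at hr; exact hε hr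
    simp [(yKN_hasDerivAt r hr0).deriv, hr0]
  σ_analytic := by intro ξ _; fun_prop
  σ_fix := by simp
  σ_invol := by simp
  σ_deck := by simp
  σ_ne_id := by
    intro ξ hξ
    simp only [Finset.mem_singleton] at hξ
    subst hξ
    filter_upwards [self_mem_nhdsWithin] with z hz h
    exact hz (self_eq_neg.mp h.symm)
  B_symm := by
    intro z₁ _ z₂ _
    rw [show (z₁ - z₂) ^ 2 = (z₂ - z₁) ^ 2 by ring]
  B_regular := by
    intro z₁ _ z₂ _ h
    refine AnalyticAt.div analyticAt_const ((analyticAt_fst.sub analyticAt_snd).pow 2) ?_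
    exact pow_ne_zero 2 (sub_ne_zero.mpr h)
  B_diag := by
    intro z _
    exact ⟨fun _ => 0, analyticAt_const, Filter.Eventually.of_forall fun p _ => by simp⟩

/-- The action of `ℤ₂ = {1, -1}` generated by `ι(z) = -1/z`. -/
def iotaAction (γ : ℤˣ) (z : ℂ) : ℂ := if γ = 1 then z else -1 / z

/-- The `ℤ₂`-equivariant bidifferential
`dz₁ dz₂ / (z₁-z₂)² + dι(z₁) dz₂ / (ι(z₁)-z₂)²`, where `dι(z₁) = dz₁ / z₁²`. -/
def spinB (z₁ z₂ : ℂ) : ℂ :=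
  1 / (z₁ - z₂) ^ 2 + (1 / z₁ ^ 2) / (-1 / z₁ - z₂) ^ 2

lemma iotaAction_one : iotaAction 1 = fun z => z := by funext z; simp [iotaAction]

lemma iotaAction_neg : iotaAction (-1) = fun z => -1 / z := by
  funext z; simp [iotaAction]

lemma hasDerivAt_iota {z : ℂ} (hz : z ≠ 0) :
    HasDerivAt (fun z : ℂ => -1 / z) (1 / z ^ 2) z := by
  have h : HasDerivAt (fun z : ℂ => -z⁻¹) (- -(z ^ 2)⁻¹) z := (hasDerivAt_inv hz).neg
  simpa [neg_div] using h

lemma deriv_spin_x (s : ℂ) {z : ℂ} (hz : z ≠ 0) :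
    HasDerivAt (fun z : ℂ => s * (z + 1 / z)) (s * (1 - 1 / z ^ 2)) z := by
  have h : HasDerivAt (fun z : ℂ => s * (z + z⁻¹)) (s * (1 + -(z ^ 2)⁻¹)) z :=
    ((hasDerivAt_id z).add (hasDerivAt_inv hz)).const_mul s
  simpa [sub_eq_add_neg] using h

lemma spinB_eq {z₁ z₂ : ℂ} (h : z₁ ≠ 0) :
    spinB z₁ z₂ = 1 / (z₁ - z₂) ^ 2 + 1 / (1 + z₁ * z₂) ^ 2 := by
  unfold spinB
  rw [div_div, ← mul_pow, show z₁ * (-1 / z₁ - z₂) = -(1 + z₁ * z₂) by field_simp; ring, neg_sq]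

/-- The `ℤ₂`-equivariant spectral curve `x = √(ε/2) (z + 1/z)`, `y = 2 log z`,
`B = dz₁ dz₂ / (z₁-z₂)² + dι(z₁) dz₂ / (ι(z₁)-z₂)²`, `ι(z) = -1/z`; `χ = υ` is the sign character and
`β` is trivial.  The ramification points are `±1`, and `σ(z) = 1/z` at both.  The branch of `log z` near `ξ`
is `log (z/ξ) + log ξ`.  Here `s` is a chosen square root of `ε/2`.  The curve is the projective line without
the poles `0`, `∞` of `dx` and the fixed points `±i` of `ι`. -/
def curveSpin (ε s : ℂ) (hε : ε ≠ 0) (hs : s ^ 2 = ε / 2) : EquivariantSpectralCurve ℤˣ where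
  carrier := {z | z ≠ 0 ∧ z ^ 2 ≠ -1}
  isOpen_carrier := by
    refine IsOpen.inter isOpen_ne ?_
    exact isOpen_ne_fun (by fun_prop) (by fun_prop)
  ram := {1, -1}
  ram_subset := by
    intro z hz
    simp only [Finset.coe_insert, Finset.coe_singleton, Set.mem_insert_iff,
      Set.mem_singleton_iff] at hz
    rcases hz with rfl | rfl <;> constructor <;> norm_num
  x := fun z => s * (z + 1 / z)
  y := fun ξ z => 2 * (Complex.log (z / ξ) + Complex.log ξ)
  σ := fun _ z => 1 / z
  B := spinB
  φ := iotaAction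
  dy := fun z => 2 / z
  χ := Units.map (Int.castRingHom ℂ).toMonoidHom
  υ := Units.map (Int.castRingHom ℂ).toMonoidHom
  β := 1
  x_holo := fun z hz => (deriv_spin_x s hz.1).differentiableAt.differentiableWithinAt
  x_crit := by
    intro ξ hξ
    have : ξ ≠ 0 ∧ ξ ^ 2 = 1 := by
      simp only [Finset.mem_insert, Finset.mem_singleton] at hξ
      rcases hξ with rfl | rfl <;> norm_num
    rw [(deriv_spin_x s this.1).deriv, this.2]
    simp
  x_simple := by
    have hs0 : s ≠ 0 := by
      rintro rfl
      apply hε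
      simpa using hs.symm
    intro ξ hξ
    have hξ' : ξ ≠ 0 := by
      simp only [Finset.mem_insert, Finset.mem_singleton] at hξ
      rcases hξ with rfl | rfl <;> norm_num
    have h1 : deriv (fun z : ℂ => s * (z + 1 / z)) =ᶠ[𝓝 ξ] fun z => s * (1 - 1 / z ^ 2) := by
      filter_upwards [isOpen_ne.mem_nhds hξ'] with z hz
      exact (deriv_spin_x s hz).deriv
    have h2 : HasDerivAt (fun z : ℂ => s * (1 - 1 / z ^ 2)) (s * (2 / ξ ^ 3)) ξ := by
      have h : HasDerivAt (fun z : ℂ => s * (1 - (z ^ 2)⁻¹)) _ ξ :=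
        (((hasDerivAt_pow 2 ξ).inv (pow_ne_zero 2 hξ')).const_sub 1).const_mul s
      have e : s * (2 / ξ ^ 3) = s * -(-(((2 : ℕ) : ℂ) * ξ ^ (2 - 1)) / (ξ ^ 2) ^ 2) := by
        field_simp
        norm_num
      rw [e]
      simpa only [one_div] using h
    rw [h1.deriv_eq, h2.deriv]
    exact mul_ne_zero hs0 (div_ne_zero two_ne_zero (pow_ne_zero 3 hξ'))
  y_analytic := by
    intro ξ hξ
    have hξ' : ξ ≠ 0 := by
      simp only [Finset.mem_insert, Finset.mem_singleton] at hξ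
      rcases hξ with rfl | rfl <;> norm_num
    refine analyticAt_const.mul (AnalyticAt.add ?_ analyticAt_const)
    refine AnalyticAt.clog (by fun_prop) ?_
    simp [div_self hξ']
  dy_ne_zero := by
    intro ξ hξ
    have hξ' : ξ ≠ 0 := by
      simp only [Finset.mem_insert, Finset.mem_singleton] at hξ
      rcases hξ with rfl | rfl <;> norm_num
    have h := ((((hasDerivAt_id ξ).div_const ξ).clog (by simp [div_self hξ'])).add_const
      (Complex.log ξ)).const_mul 2
    have h' : HasDerivAt (fun z => 2 * (Complex.log (z / ξ) + Complex.log ξ)) _ ξ := h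
    rw [h'.deriv]
    simp [hξ']
  σ_analytic := by
    intro ξ hξ
    have hξ' : ξ ≠ 0 := by
      simp only [Finset.mem_insert, Finset.mem_singleton] at hξ
      rcases hξ with rfl | rfl <;> norm_num
    exact analyticAt_const.div analyticAt_id hξ'
  σ_fix := by
    intro ξ hξ
    simp only [Finset.mem_insert, Finset.mem_singleton] at hξ
    rcases hξ with rfl | rfl <;> norm_num
  σ_invol := by simp
  σ_deck := by
    intro ξ _
    refine Filter.Eventually.of_forall fun z => ?_
    simp [add_comm]
  σ_ne_id := by
    intro ξ hξ
    have hmem : {z : ℂ | z ≠ 0 ∧ z ≠ -ξ} ∈ 𝓝 ξ := by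
      have hξ' : ξ ≠ 0 ∧ ξ ≠ -ξ := by
        simp only [Finset.mem_insert, Finset.mem_singleton] at hξ
        rcases hξ with rfl | rfl <;> norm_num [Complex.ext_iff]
      exact (isOpen_ne.inter isOpen_ne).mem_nhds hξ'
    filter_upwards [self_mem_nhdsWithin, mem_nhdsWithin_of_mem_nhds hmem] with z hz hz' h
    rw [div_eq_iff hz'.1] at h
    have h' : (z - 1) * (z + 1) = 0 := by linear_combination -h
    simp only [Finset.mem_insert, Finset.mem_singleton] at hξ
    rcases mul_eq_zero.mp h' with h1 | h1 <;> rcases hξ with rfl | rfl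
    · exact hz (by simpa using sub_eq_zero.mp h1)
    · exact hz'.2 (by simpa using sub_eq_zero.mp h1)
    · exact hz'.2 (eq_neg_of_add_eq_zero_left h1)
    · exact hz (eq_neg_of_add_eq_zero_left h1)
  B_symm := by
    intro z₁ h₁ z₂ h₂
    rw [spinB_eq h₁.1, spinB_eq h₂.1, mul_comm z₁ z₂,
      show (z₁ - z₂) ^ 2 = (z₂ - z₁) ^ 2 by ring]
  φ_mapsTo := by
    intro γ z hz
    rcases Int.units_eq_one_or γ with rfl | rfl
    · simpa [iotaAction_one] using hz
    · have hz1 := hz.1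
      refine ⟨by simp [iotaAction_neg, hz.1], ?_⟩
      rw [iotaAction_neg]
      intro h
      field_simp at h
      exact hz.2 (by linear_combination h)
  φ_holo := by
    intro γ z hz
    rcases Int.units_eq_one_or γ with rfl | rfl
    · rw [iotaAction_one]; exact differentiableWithinAt_id
    · rw [iotaAction_neg]
      exact (hasDerivAt_iota hz.1).differentiableAt.differentiableWithinAt
  φ_one := by simp [iotaAction_one]
  φ_mul := by
    intro γ η z _
    rcases Int.units_eq_one_or γ with rfl | rfl <;> rcases Int.units_eq_one_or η with rfl | rfl <;>
      simp [iotaAction_one, iotaAction_neg]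
  φ_free := by
    intro γ z hz h
    rcases Int.units_eq_one_or γ with rfl | rfl
    · rfl
    · rw [iotaAction_neg] at h
      have h' : -1 / z = z := h
      rw [div_eq_iff hz.1] at h'
      exact absurd (by linear_combination -h') hz.2
  x_crit_all := by
    have hs0 : s ≠ 0 := by
      rintro rfl
      apply hε
      simpa using hs.symm
    intro z hz h
    have hz1 := hz.1
    rw [(deriv_spin_x s hz.1).deriv] at h
    have h1 := (mul_eq_zero.mp h).resolve_left hs0
    field_simp at h1
    have h' : (z - 1) * (z + 1) = 0 := by linear_combination h1
    simp only [Finset.mem_insert, Finset.mem_singleton]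
    rcases mul_eq_zero.mp h' with h2 | h2
    · exact Or.inl (sub_eq_zero.mp h2)
    · exact Or.inr (eq_neg_of_add_eq_zero_left h2)
  dy_mero := by intro z _; fun_prop
  dy_spec := by
    intro ξ hξ
    have hξ' : ξ ≠ 0 := by
      simp only [Finset.mem_insert, Finset.mem_singleton] at hξ
      rcases hξ with rfl | rfl <;> norm_num
    have hc : ContinuousAt (fun z : ℂ => z / ξ) ξ := by fun_prop
    have hmem : ∀ᶠ z in 𝓝 ξ, z / ξ ∈ Complex.slitPlane :=
      hc.eventually (Complex.isOpen_slitPlane.mem_nhds (by simp [div_self hξ']))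
    filter_upwards [hmem, isOpen_ne.mem_nhds hξ'] with z hz hz0
    have h := ((((hasDerivAt_id z).div_const ξ).clog hz).add_const (Complex.log ξ)).const_mul 2
    have h' : HasDerivAt (fun z => 2 * (Complex.log (z / ξ) + Complex.log ξ)) _ z := h
    have hz1 : z ≠ 0 := hz0
    have e : 2 / z = 2 * (1 / ξ / (id z / ξ)) := by
      simp only [id]
      field_simp
    rw [e]
    exact h'
  dx_equiv := by
    intro γ z hz
    have hz1 := hz.1
    rcases Int.units_eq_one_or γ with rfl | rfl
    · simp [iotaAction_one]
    · rw [iotaAction_neg, (hasDerivAt_iota hz.1).deriv,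
        (deriv_spin_x s (z := -1 / z) (by simp [hz1])).deriv, (deriv_spin_x s hz1).deriv]
      simp
      field_simp
      ring
  dy_equiv := by
    intro γ z hz
    have hz1 := hz.1
    rcases Int.units_eq_one_or γ with rfl | rfl
    · simp [iotaAction_one]
    · rw [iotaAction_neg, (hasDerivAt_iota hz.1).deriv]
      simp
      field_simp
  B_equiv := by
    intro γ z₁ h₁ z₂ _
    have hz1 := h₁.1
    rcases Int.units_eq_one_or γ with rfl | rfl
    · simp [iotaAction_one]
    · rw [iotaAction_neg, (hasDerivAt_iota hz1).deriv]
      have e1 : -1 / (-1 / z₁) = z₁ := by field_simp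
      have e2 : 1 / (-1 / z₁) ^ 2 = z₁ ^ 2 := by field_simp
      simp only [spinB, e1, e2, MonoidHom.one_apply, Units.val_one]
      have e3 : z₁ ^ 2 / (z₁ - z₂) ^ 2 * (1 / z₁ ^ 2) = 1 / (z₁ - z₂) ^ 2 := by
        rw [div_mul_div_comm, mul_one, mul_comm ((z₁ - z₂) ^ 2), ← div_div,
          div_self (pow_ne_zero 2 hz1)]
      rw [add_mul, e3]
      ring
  B_regular := by
    intro z₁ h₁ z₂ _ h
    have hz1 := h₁.1
    have ha := h 1
    have hb := h (-1)
    rw [iotaAction_one] at ha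
    rw [iotaAction_neg] at hb
    have c1 : AnalyticAt ℂ (fun p : ℂ × ℂ => p.1) (z₁, z₂) := analyticAt_fst
    have c2 : AnalyticAt ℂ (fun p : ℂ × ℂ => p.2) (z₁, z₂) := analyticAt_snd
    unfold spinB
    refine AnalyticAt.add ?_ (AnalyticAt.div ?_ ?_ ?_)
    · exact analyticAt_const.div ((c1.sub c2).pow 2) (pow_ne_zero 2 (sub_ne_zero.mpr ha))
    · exact analyticAt_const.div (c1.pow 2) (pow_ne_zero 2 hz1)
    · exact ((analyticAt_const.div c1 hz1).sub c2).pow 2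
    · exact pow_ne_zero 2 (sub_ne_zero.mpr hb)
  B_orbit := by
    intro γ z hz
    refine ⟨fun _ => 0, analyticAt_const, ?_⟩
    have h0 : iotaAction γ z ≠ 0 := by
      rcases Int.units_eq_one_or γ with rfl | rfl
      · simpa [iotaAction_one] using hz.1
      · simpa [iotaAction_neg] using hz.1
    have hmem : ∀ᶠ p : ℂ × ℂ in 𝓝 (iotaAction γ z, z), p.1 ≠ 0 :=
      continuousAt_fst.eventually_ne h0
    filter_upwards [hmem] with p hp _
    have : (Finset.univ : Finset ℤˣ) = {1, -1} := by decide
    rw [this, Finset.sum_pair (by decide), iotaAction_one, iotaAction_neg,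
      (hasDerivAt_iota hp).deriv]
    simp [spinB]

end TopRec

end

open scoped Topology

noncomputable section

namespace TopRec

/-! The map `w = s (z - 1/z)` is the quotient of the `z`-line by `ι`. It is unramified at `±1`,
which both lie over `w = 0`, and it intertwines `z ↦ 1/z` with `w ↦ -w`. Since `x² = w² + 2ε`, one
has `x dx = w dw`, so `y dx` is the pull-back of `ỹ dx̃` up to the additive constant in the branch
of `y`. Since `w₁ - w₂ = s (z₁ - z₂)(1 + z₁z₂)/(z₁z₂)`, the bidifferential `B` is exactly the
pull-back of `B̃`. Hence the recursion kernels correspond (`eventually_kernel_eq`). By induction on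
`2g + m`, the integrand at each of `±1` is `2^(2g-2+m)` times the pull-back of the integrand at `w =
0` (`PullbackHolds.eventually_integrand_eq`). The two points contribute equally, which supplies the
last factor `2` (`pullbackHolds`).

The analytic point is that residues, given as limits of circle integrals, are invariant under this
change of coordinate. This holds for a finite Laurent expansion with analytic remainder
(`hasRes_comp_of_laurent`). To know that the integrand on the `w`-line has one, a separate induction
shows that each stable differential there is a polynomial in the `1 / wᵢ` (`isLaurentKN`): the class
`IsMero` is closed under the operations of the recursion, and its residues are again such
polynomials (`IsMero.exists_hasRes`). -/

/-! ### Residues as circle integrals. -/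

/-- On all small circles around `ξ`, `f` is integrable with `∮ f = 2πi c`. -/
def HasRes (f : ℂ → ℂ) (ξ c : ℂ) : Prop :=
  ∀ᶠ r in 𝓝[>] (0 : ℝ), CircleIntegrable f ξ r ∧ (∮ z in C(ξ, r), f z) = 2 * Real.pi * Complex.I * c

/-- A property holding on a punctured neighbourhood of `ξ` holds on all small circles around `ξ`. -/
lemma eventually_forall_sphere {p : ℂ → Prop} {ξ : ℂ} (h : ∀ᶠ z in 𝓝[≠] ξ, p z) :
    ∀ᶠ r in 𝓝[>] (0 : ℝ), 0 < r ∧ ∀ z ∈ Metric.sphere ξ r, p z := by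
  rw [eventually_nhdsWithin_iff, Metric.eventually_nhds_iff] at h
  obtain ⟨δ, hδ, h⟩ := h
  filter_upwards [Ioo_mem_nhdsGT hδ] with r hr
  refine ⟨hr.1, fun z hz => h ?_ ?_⟩
  · rw [Metric.mem_sphere.mp hz]; exact hr.2
  · rintro rfl
    simp [hr.1.ne] at hz

namespace HasRes

variable {f g : ℂ → ℂ} {ξ a b : ℂ}

lemma residue_eq (h : HasRes f ξ a) : residue f ξ = a := by
  refine Filter.Tendsto.limUnder_eq (tendsto_const_nhds.congr' ?_)
  filter_upwards [h] with r hr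
  rw [hr.2, inv_mul_cancel_left₀ Complex.two_pi_I_ne_zero]

lemma congr (h : HasRes f ξ a) (hfg : ∀ᶠ z in 𝓝[≠] ξ, g z = f z) : HasRes g ξ a := by
  filter_upwards [h, eventually_forall_sphere hfg] with r hr hs
  refine ⟨?_, ?_⟩
  · refine (circleIntegrable_congr ?_).mp hr.1
    rw [abs_of_pos hs.1]
    exact fun z hz => (hs.2 z hz).symm
  · rw [← hr.2]
    exact circleIntegral.integral_congr hs.1.le hs.2

lemma add (hf : HasRes f ξ a) (hg : HasRes g ξ b) : HasRes (fun z => f z + g z) ξ (a + b) := by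
  filter_upwards [hf, hg] with r h1 h2
  refine ⟨h1.1.add h2.1, ?_⟩
  rw [circleIntegral.integral_add h1.1 h2.1, h1.2, h2.2]
  ring

lemma const_mul (c : ℂ) (hf : HasRes f ξ a) : HasRes (fun z => c * f z) ξ (c * a) := by
  filter_upwards [hf] with r h1
  refine ⟨h1.1.const_smul (a := c), ?_⟩
  rw [circleIntegral.integral_const_mul, h1.2]
  ring

lemma zero : HasRes (fun _ => 0) ξ 0 :=
  Filter.Eventually.of_forall fun r => ⟨circleIntegrable_const 0 ξ r, by simp [circleIntegral]⟩

lemma sum {ι : Type*} (s : Finset ι) {F : ι → ℂ → ℂ} {c : ι → ℂ}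
    (h : ∀ i ∈ s, HasRes (F i) ξ (c i)) : HasRes (fun z => ∑ i ∈ s, F i z) ξ (∑ i ∈ s, c i) := by
  classical
  induction s using Finset.induction_on with
  | empty => simpa using zero
  | insert i s hi ih =>
    simp only [Finset.sum_insert hi]
    exact (h i (Finset.mem_insert_self i s)).add
      (ih fun j hj => h j (Finset.mem_insert_of_mem hj))

/-- Nothing is assumed at `ξ` itself: a single-valued primitive along the circle suffices. This
disposes of all powers other than `-1`. -/
lemma of_hasDerivAt (hd : ∀ᶠ z in 𝓝[≠] ξ, HasDerivAt g (f z) z)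
    (hc : ∀ᶠ z in 𝓝[≠] ξ, ContinuousAt f z) : HasRes f ξ 0 := by
  filter_upwards [eventually_forall_sphere hd, eventually_forall_sphere hc] with r h1 h2
  refine ⟨ContinuousOn.circleIntegrable h1.1.le fun z hz => (h2.2 z hz).continuousWithinAt, ?_⟩
  rw [mul_zero]
  exact circleIntegral.integral_eq_zero_of_hasDerivWithinAt h1.1.le
    fun z hz => (h1.2 z hz).hasDerivWithinAt

lemma of_analyticAt (hf : AnalyticAt ℂ f ξ) : HasRes f ξ 0 := by
  obtain ⟨δ, hδ, h⟩ := Metric.eventually_nhds_iff.mp hf.eventually_analyticAt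
  have hd : DifferentiableOn ℂ f (Metric.ball ξ δ) :=
    fun z hz => (h hz).differentiableAt.differentiableWithinAt
  filter_upwards [Ioo_mem_nhdsGT hδ] with r hr
  have hsub : Metric.closedBall ξ r ⊆ Metric.ball ξ δ := Metric.closedBall_subset_ball hr.2
  refine ⟨ContinuousOn.circleIntegrable hr.1.le
    ((hd.continuousOn.mono hsub).mono Metric.sphere_subset_closedBall), ?_⟩
  rw [mul_zero]
  exact DiffContOnCl.circleIntegral_eq_zero hr.1.le (hd.diffContOnCl_ball hsub)

lemma sub_inv : HasRes (fun z => (z - ξ)⁻¹) ξ 1 := by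
  filter_upwards [self_mem_nhdsWithin] with r hr
  have hr' : (0 : ℝ) < r := hr
  refine ⟨?_, by rw [circleIntegral.integral_sub_center_inv ξ hr'.ne', mul_one]⟩
  rw [circleIntegrable_sub_inv_iff]
  right
  simp [hr'.ne', eq_comm]

end HasRes

/-! ### Invariance of residues under a change of coordinate. -/

/-- Writing `φ = (z - ξ) ψ` with `ψ ξ ≠ 0` gives `φ'/φ = 1/(z - ξ) + ψ'/ψ`, and the last term is
analytic. -/
lemma hasRes_logDeriv {φ : ℂ → ℂ} {ξ : ℂ} (hφ : AnalyticAt ℂ φ ξ) (h0 : φ ξ = 0)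
    (h1 : deriv φ ξ ≠ 0) : HasRes (fun z => (φ z)⁻¹ * deriv φ z) ξ 1 := by
  obtain ⟨p, hp⟩ := hφ
  have hψ : AnalyticAt ℂ (dslope φ ξ) ξ := hp.has_fpower_series_dslope_fslope.analyticAt
  have hne : dslope φ ξ ξ ≠ 0 := by simpa using h1
  have hR : AnalyticAt ℂ (fun z => (dslope φ ξ z)⁻¹ * deriv (dslope φ ξ) z) ξ :=
    (hψ.inv hne).mul hψ.deriv
  have hfac : ∀ z, φ z = (z - ξ) * dslope φ ξ z := fun z => by
    have := sub_smul_dslope φ ξ z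
    simp only [smul_eq_mul, h0, sub_zero] at this
    exact this.symm
  have key := (HasRes.sub_inv (ξ := ξ)).add (HasRes.of_analyticAt hR)
  rw [add_zero] at key
  refine key.congr ?_
  have e1 := hψ.continuousAt.eventually_ne hne
  filter_upwards [self_mem_nhdsWithin, mem_nhdsWithin_of_mem_nhds e1,
    mem_nhdsWithin_of_mem_nhds hψ.eventually_analyticAt] with z hz hz1 hz2
  have hz' : z - ξ ≠ 0 := sub_ne_zero.mpr hz
  have hz1' : dslope φ ξ z ≠ 0 := hz1
  have hder : HasDerivAt φ (1 * dslope φ ξ z + (z - ξ) * deriv (dslope φ ξ) z) z := by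
    have := ((hasDerivAt_id z).sub_const ξ).mul hz2.differentiableAt.hasDerivAt
    exact this.congr_of_eventuallyEq (Filter.Eventually.of_forall hfac)
  rw [hder.deriv, hfac z]
  field_simp

/-- For `n ≠ -1` the function `φ^(n+1)/(n+1)` is a primitive on a punctured neighbourhood. -/
lemma hasRes_zpow_mul_deriv {φ : ℂ → ℂ} {ξ : ℂ} (hφ : AnalyticAt ℂ φ ξ) (h0 : φ ξ = 0)
    (h1 : deriv φ ξ ≠ 0) (n : ℤ) :
    HasRes (fun z => φ z ^ n * deriv φ z) ξ (if n = -1 then 1 else 0) := by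
  split_ifs with hn
  · subst hn
    simpa using hasRes_logDeriv hφ h0 h1
  · have hn' : ((n + 1 : ℤ) : ℂ) ≠ 0 := by
      exact_mod_cast fun h => hn (by omega)
    have hne : ∀ᶠ z in 𝓝[≠] ξ, φ z ≠ 0 := by
      have := hφ.differentiableAt.hasDerivAt.eventually_ne h1 (c := 0)
      simpa using this
    have han : ∀ᶠ z in 𝓝[≠] ξ, AnalyticAt ℂ φ z :=
      hφ.eventually_analyticAt.filter_mono nhdsWithin_le_nhds
    refine HasRes.of_hasDerivAt (g := fun z => φ z ^ (n + 1) / ((n + 1 : ℤ) : ℂ)) ?_ ?_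
    · filter_upwards [hne, han] with z hz hz'
      have h := ((hasDerivAt_zpow (n + 1) (φ z) (Or.inl hz)).comp z
        hz'.differentiableAt.hasDerivAt).div_const ((n + 1 : ℤ) : ℂ)
      have e : φ z ^ n * deriv φ z =
          ((n + 1 : ℤ) : ℂ) * φ z ^ (n + 1 - 1) * deriv φ z / ((n + 1 : ℤ) : ℂ) := by
        rw [add_sub_cancel_right]
        field_simp
      rw [e]
      exact h
    · filter_upwards [hne, han] with z hz hz'
      exact (hz'.continuousAt.zpow₀ n (Or.inl hz)).mul hz'.deriv.continuousAt

/-- The residue of a finite Laurent expansion does not depend on the coordinate. -/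
lemma hasRes_comp_of_laurent {f R φ : ℂ → ℂ} {ξ : ℂ} (hφ : AnalyticAt ℂ φ ξ) (h0 : φ ξ = 0)
    (h1 : deriv φ ξ ≠ 0) {s : Finset ℕ} {c : ℕ → ℂ} {K : ℕ} (hR : AnalyticAt ℂ R 0)
    (hf : ∀ᶠ w in 𝓝[≠] 0, f w = ∑ i ∈ s, c i * w ^ ((i : ℤ) - K) + R w) :
    HasRes (fun z => f (φ z) * deriv φ z) ξ
      (∑ i ∈ s, c i * if (i : ℤ) - K = -1 then 1 else 0) := by
  have hR' : AnalyticAt ℂ (fun z => R (φ z) * deriv φ z) ξ :=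
    (AnalyticAt.comp (by rwa [h0]) hφ).mul hφ.deriv
  have key := (HasRes.sum s fun i _ =>
    (hasRes_zpow_mul_deriv hφ h0 h1 ((i : ℤ) - K)).const_mul (c i)).add (HasRes.of_analyticAt hR')
  rw [add_zero] at key
  refine key.congr ?_
  have ht : Filter.Tendsto φ (𝓝[≠] ξ) (𝓝[≠] 0) := by
    have := hφ.differentiableAt.hasDerivAt.tendsto_nhdsNE h1
    rwa [h0] at this
  filter_upwards [ht.eventually hf] with z hz
  rw [hz, add_mul, Finset.sum_mul]
  simp only [mul_assoc]

/-! ### Families of Laurent germs with coefficients polynomial in the inverse parameters. -/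

/-- Taylor expansion with analytic remainder. -/
lemma exists_polynomial_add_pow_mul {g : ℂ → ℂ} (hg : AnalyticAt ℂ g 0) (N : ℕ) :
    ∃ (q : Polynomial ℂ) (R : ℂ → ℂ), AnalyticAt ℂ R 0 ∧ ∀ w, g w = q.eval w + w ^ N * R w := by
  induction N with
  | zero => exact ⟨0, g, hg, by simp⟩
  | succ N ih =>
    obtain ⟨q, R, hR, h⟩ := ih
    obtain ⟨p, hp⟩ := hR
    refine ⟨q + Polynomial.C (R 0) * Polynomial.X ^ N, dslope R 0,
      hp.has_fpower_series_dslope_fslope.analyticAt, fun w => ?_⟩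
    have := sub_smul_dslope R 0 w
    simp only [smul_eq_mul, sub_zero] at this
    rw [h w]
    simp only [Polynomial.eval_add, Polynomial.eval_mul, Polynomial.eval_C, Polynomial.eval_pow,
      Polynomial.eval_X, pow_succ]
    linear_combination (-w ^ N) * this

open Polynomial in
/-- Evaluation of a polynomial in `w` over `ℂ[uᵢ]` at `uᵢ = 1 / pᵢ`. -/
def evalInv {ι : Type*} (p : ι → ℂ) (w : ℂ) : (MvPolynomial ι ℂ)[X] →+* ℂ :=
  eval₂RingHom (MvPolynomial.eval fun i => (p i)⁻¹) w

section evalInv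

variable {ι : Type*} (p : ι → ℂ) (w : ℂ)

@[simp] lemma evalInv_X : evalInv p w Polynomial.X = w := by simp [evalInv]

@[simp] lemma evalInv_C (q : MvPolynomial ι ℂ) :
    evalInv p w (Polynomial.C q) = MvPolynomial.eval (fun i => (p i)⁻¹) q := by simp [evalInv]

end evalInv

/-- A family of germs at `0`, indexed by tuples `p` of nonzero numbers, of meromorphic functions with
uniformly bounded pole order and Laurent coefficients that are polynomials in the `1 / pᵢ`. -/
def IsMero {ι : Type*} (F : (ι → ℂ) → ℂ → ℂ) : Prop :=
  ∃ K : ℕ, ∀ N : ℕ, ∃ Q : Polynomial (MvPolynomial ι ℂ), ∀ p : ι → ℂ, (∀ i, p i ≠ 0) →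
    ∃ R : ℂ → ℂ, AnalyticAt ℂ R 0 ∧ ∀ᶠ w in 𝓝[≠] 0, w ^ K * F p w = evalInv p w Q + w ^ N * R w

namespace IsMero

variable {ι : Type*} {F G : (ι → ℂ) → ℂ → ℂ}

lemma congr (hF : IsMero F)
    (h : ∀ p : ι → ℂ, (∀ i, p i ≠ 0) → ∀ᶠ w in 𝓝[≠] 0, G p w = F p w) : IsMero G := by
  obtain ⟨K, hK⟩ := hF
  refine ⟨K, fun N => ?_⟩
  obtain ⟨Q, hQ⟩ := hK N
  refine ⟨Q, fun p hp => ?_⟩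
  obtain ⟨R, hR, hw⟩ := hQ p hp
  refine ⟨R, hR, ?_⟩
  filter_upwards [hw, h p hp] with w h1 h2
  rw [h2, h1]

/-- Pole orders add under multiplication, while a residue needs an expansion at least up to the pole
order. This is why the truncation order `N` is left arbitrary in `IsMero`. -/
lemma mul (hF : IsMero F) (hG : IsMero G) : IsMero (fun p w => F p w * G p w) := by
  obtain ⟨K, hK⟩ := hF
  obtain ⟨L, hL⟩ := hG
  refine ⟨K + L, fun N => ?_⟩
  obtain ⟨Q, hQ⟩ := hK N
  obtain ⟨T, hT⟩ := hL N
  refine ⟨Q * T, fun p hp => ?_⟩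
  obtain ⟨R, hR, h1⟩ := hQ p hp
  obtain ⟨S, hS, h2⟩ := hT p hp
  have aQ : AnalyticAt ℂ (fun w => evalInv p w Q) 0 := by
    simp only [evalInv, Polynomial.coe_eval₂RingHom, Polynomial.eval₂_eq_sum_range]
    fun_prop
  have aT : AnalyticAt ℂ (fun w => evalInv p w T) 0 := by
    simp only [evalInv, Polynomial.coe_eval₂RingHom, Polynomial.eval₂_eq_sum_range]
    fun_prop
  refine ⟨fun w => evalInv p w Q * S w + R w * evalInv p w T + w ^ N * (R w * S w), by fun_prop, ?_⟩
  filter_upwards [h1, h2] with w e1 e2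
  rw [map_mul, pow_add]
  linear_combination (w ^ L * G p w) * e1 + (evalInv p w Q + w ^ N * R w) * e2

lemma add (hF : IsMero F) (hG : IsMero G) : IsMero (fun p w => F p w + G p w) := by
  obtain ⟨K, hK⟩ := hF
  obtain ⟨L, hL⟩ := hG
  refine ⟨K + L, fun N => ?_⟩
  obtain ⟨Q, hQ⟩ := hK N
  obtain ⟨T, hT⟩ := hL N
  refine ⟨Polynomial.X ^ L * Q + Polynomial.X ^ K * T, fun p hp => ?_⟩
  obtain ⟨R, hR, h1⟩ := hQ p hp
  obtain ⟨S, hS, h2⟩ := hT p hp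
  refine ⟨fun w => w ^ L * R w + w ^ K * S w, by fun_prop, ?_⟩
  filter_upwards [h1, h2] with w e1 e2
  rw [map_add, map_mul, map_mul, map_pow, map_pow, evalInv_X, pow_add]
  linear_combination w ^ L * e1 + w ^ K * e2

lemma coeff (q : MvPolynomial ι ℂ) :
    IsMero (fun p (_ : ℂ) => MvPolynomial.eval (fun i => (p i)⁻¹) q) :=
  ⟨0, fun _ => ⟨Polynomial.C q, fun _ _ => ⟨fun _ => 0, analyticAt_const, by simp⟩⟩⟩

lemma const (c : ℂ) : IsMero (fun (_ : ι → ℂ) (_ : ℂ) => c) := by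
  simpa using coeff (ι := ι) (MvPolynomial.C c)

lemma param_inv (i : ι) : IsMero (fun (p : ι → ℂ) (_ : ℂ) => (p i)⁻¹) := by
  simpa using coeff (ι := ι) (MvPolynomial.X i)

lemma sum {α : Type*} (s : Finset α) {H : α → (ι → ℂ) → ℂ → ℂ} (h : ∀ a ∈ s, IsMero (H a)) :
    IsMero (fun p w => ∑ a ∈ s, H a p w) := by
  classical
  induction s using Finset.induction_on with
  | empty => simpa using const (ι := ι) 0
  | insert a s ha ih =>
    simp only [Finset.sum_insert ha]
    exact (h a (Finset.mem_insert_self a s)).add (ih fun b hb => h b (Finset.mem_insert_of_mem hb))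

lemma of_meromorphicAt {f : ℂ → ℂ} (hf : MeromorphicAt f 0) :
    IsMero (fun (_ : ι → ℂ) w => f w) := by
  obtain ⟨K, hK⟩ := hf
  refine ⟨K, fun N => ?_⟩
  obtain ⟨q, R, hR, h⟩ := exists_polynomial_add_pow_mul hK N
  refine ⟨q.map MvPolynomial.C, fun p _ => ⟨R, hR, Filter.Eventually.of_forall fun w => ?_⟩⟩
  have := h w
  simp only [sub_zero, smul_eq_mul] at this
  rw [this]
  congr 1
  simp only [evalInv, Polynomial.coe_eval₂RingHom, Polynomial.eval₂_map]
  rw [show (MvPolynomial.eval fun i => (p i)⁻¹).comp MvPolynomial.C = RingHom.id ℂ from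
    RingHom.ext fun c => by simp]
  rfl

/-- A truncated geometric series in `c w / pᵢ`, with coefficients `c^k (1/pᵢ)^(k+1)`. The
neighbourhood on which the remainder is analytic shrinks with `pᵢ`, so only germs for each fixed `p`
can be asked for. -/
lemma inv_param_sub (i : ι) (c : ℂ) :
    IsMero (fun (p : ι → ℂ) w => (p i - c * w)⁻¹) := by
  refine ⟨0, fun N => ⟨∑ k ∈ Finset.range N,
    Polynomial.C (MvPolynomial.C (c ^ k) * MvPolynomial.X i ^ (k + 1)) * Polynomial.X ^ k,
    fun p hp => ?_⟩⟩
  have hne : p i - c * 0 ≠ 0 := by simpa using hp i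
  refine ⟨fun w => (c / p i) ^ N * (p i - c * w)⁻¹,
    analyticAt_const.mul (AnalyticAt.inv (by fun_prop) hne), ?_⟩
  have hc : ContinuousAt (fun w : ℂ => p i - c * w) 0 := by fun_prop
  filter_upwards [mem_nhdsWithin_of_mem_nhds (hc.eventually_ne hne)] with w hw
  have hw' : p i - c * w ≠ 0 := hw
  have hpi := hp i
  have key : ∑ k ∈ Finset.range N, (c * w / p i) ^ k =
      ((c * w / p i) ^ N - 1) / (c * w / p i - 1) := by
    refine geom_sum_eq ?_ N
    intro h
    rw [div_eq_one_iff_eq hpi] at h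
    exact hw' (by rw [h, sub_self])
  have e1 : evalInv p w (∑ k ∈ Finset.range N,
      Polynomial.C (MvPolynomial.C (c ^ k) * MvPolynomial.X i ^ (k + 1)) * Polynomial.X ^ k) =
      (p i)⁻¹ * ∑ k ∈ Finset.range N, (c * w / p i) ^ k := by
    rw [map_sum, Finset.mul_sum]
    refine Finset.sum_congr rfl fun k _ => ?_
    simp only [map_mul, evalInv_C, map_pow, evalInv_X, MvPolynomial.eval_C, MvPolynomial.eval_X]
    rw [div_pow, mul_pow, inv_pow, pow_succ]
    field_simp
  rw [e1, key]
  have e2 : c * w / p i - 1 = -(p i - c * w) / p i := by field_simp; ring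
  rw [e2, div_pow, div_pow, mul_pow]
  field_simp
  ring

lemma eval_mvPolynomial {κ : Type*} {v : κ → (ι → ℂ) → ℂ → ℂ} (hv : ∀ k, IsMero (v k))
    (q : MvPolynomial κ ℂ) : IsMero (fun p w => MvPolynomial.eval (fun k => v k p w) q) := by
  induction q using MvPolynomial.induction_on with
  | C a => simpa using const (ι := ι) a
  | add q₁ q₂ h₁ h₂ => simpa using h₁.add h₂
  | mul_X q k h => simpa using h.mul (hv k)

/-- The residues form a polynomial in the `1 / pᵢ`, and are independent of the coordinate. -/
lemma exists_hasRes (hF : IsMero F) : ∃ q : MvPolynomial ι ℂ, ∀ p : ι → ℂ, (∀ i, p i ≠ 0) →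
    ∀ (φ : ℂ → ℂ) (ξ : ℂ), AnalyticAt ℂ φ ξ → φ ξ = 0 → deriv φ ξ ≠ 0 →
      HasRes (fun z => F p (φ z) * deriv φ z) ξ (MvPolynomial.eval (fun i => (p i)⁻¹) q) := by
  obtain ⟨K, hK⟩ := hF
  -- With `N = K`, dividing by `w^K` leaves an analytic remainder.
  obtain ⟨Q, hQ⟩ := hK K
  -- The integer condition selects the index `K - 1`, and nothing when `K = 0`.
  refine ⟨∑ i ∈ Finset.range (Q.natDegree + 1), if (i : ℤ) - K = -1 then Q.coeff i else 0,
    fun p hp φ ξ hφ h0 h1 => ?_⟩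
  obtain ⟨R, hR, h⟩ := hQ p hp
  have key := hasRes_comp_of_laurent (f := F p) (s := Finset.range (Q.natDegree + 1))
    (c := fun i => MvPolynomial.eval (fun i => (p i)⁻¹) (Q.coeff i)) (K := K) hφ h0 h1 hR ?_
  · convert key using 1
    rw [map_sum]
    refine Finset.sum_congr rfl fun i _ => ?_
    split_ifs <;> simp
  · filter_upwards [h, self_mem_nhdsWithin] with w hw hw0
    have hw0' : w ≠ 0 := hw0
    have e : F p w = (w ^ K)⁻¹ * evalInv p w Q + R w := by
      field_simp
      linear_combination hw
    rw [e]
    congr 1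
    simp only [evalInv, Polynomial.coe_eval₂RingHom, Polynomial.eval₂_eq_sum_range, Finset.mul_sum]
    refine Finset.sum_congr rfl fun i _ => ?_
    rw [zpow_sub₀ hw0', zpow_natCast, zpow_natCast]
    field_simp

end IsMero

/-! ### Unfolding the recursion and integrating along segments. -/

/-- The differential whose residues at the points `ξ` are summed in the recursion. -/
def RecursionData.integrand (D : RecursionData) (g m : ℕ) (ξ z₁ : ℂ) (zs : Fin m → ℂ) (z : ℂ) : ℂ :=
  D.kernel ξ z₁ z * deriv (D.σ ξ) z *
    ((if 0 < g then D.omegaAux (g - 1) (m + 1) z (Fin.cons (D.σ ξ z) zs) else 0) +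
      ∑ p : Fin (g + 1) × Finset (Fin m),
        if (p.1.val = 0 ∧ p.2.card = 0) ∨ (g - p.1.val = 0 ∧ (p.2ᶜ).card = 0) then 0
        else
          D.omegaAux p.1.val p.2.card z (fun j => zs (p.2.orderEmbOfFin rfl j)) *
            D.omegaAux (g - p.1.val) (p.2ᶜ).card (D.σ ξ z)
              (fun j => zs ((p.2ᶜ).orderEmbOfFin rfl j)))

lemma RecursionData.omegaAux_zero_zero (D : RecursionData) (z₁ : ℂ) (zs : Fin 0 → ℂ) :
    D.omegaAux 0 0 z₁ zs = 0 := by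
  rw [RecursionData.omegaAux]; simp

lemma RecursionData.omegaAux_zero_one (D : RecursionData) (z₁ : ℂ) (zs : Fin 1 → ℂ) :
    D.omegaAux 0 1 z₁ zs = D.B z₁ (zs 0) := by
  rw [RecursionData.omegaAux]; simp

lemma RecursionData.omegaAux_stable (D : RecursionData) {g m : ℕ} (h : 1 < 2 * g + m) (z₁ : ℂ)
    (zs : Fin m → ℂ) :
    D.omegaAux g m z₁ zs = 1 / 2 * ∑ ξ ∈ D.ram, residue (D.integrand g m ξ z₁ zs) ξ := by
  rw [RecursionData.omegaAux, if_neg (by omega), dif_neg (by omega)]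
  rfl

lemma segmentIntegral_eq_sub {f F : ℂ → ℂ} {a b : ℂ} {U : Set ℂ} (hU : Convex ℝ U) (ha : a ∈ U)
    (hb : b ∈ U) (hF : ∀ z ∈ U, HasDerivAt F (f z) z) (hf : ContinuousOn f U) :
    segmentIntegral f a b = F b - F a := by
  have hmem : ∀ t ∈ Set.uIcc (0 : ℝ) 1, a + t * (b - a) ∈ U := by
    intro t ht
    rw [Set.uIcc_of_le zero_le_one] at ht
    have := hU.add_smul_sub_mem ha hb ht
    simpa using this
  have hline : ∀ t : ℝ, HasDerivAt (fun t : ℝ => a + t * (b - a)) (b - a) t := fun t => by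
    simpa using ((Complex.ofRealCLM.hasDerivAt (x := t)).mul_const (b - a)).const_add a
  have h := intervalIntegral.integral_eq_sub_of_hasDerivAt
    (f := fun t : ℝ => F (a + t * (b - a))) (f' := fun t : ℝ => f (a + t * (b - a)) * (b - a))
    (a := 0) (b := 1) (fun t ht => (hF _ (hmem t ht)).comp t (hline t)) ?_
  · simpa [segmentIntegral] using h
  · refine ContinuousOn.intervalIntegrable (ContinuousOn.mul ?_ continuousOn_const)
    exact hf.comp (by fun_prop) hmem

lemma hasDerivAt_inv_const_sub {a z : ℂ} (h : a ≠ z) :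
    HasDerivAt (fun z => (a - z)⁻¹) (1 / (a - z) ^ 2) z := by
  have : HasDerivAt (fun z => (a - z)⁻¹) (- -1 / (a - z) ^ 2) z :=
    ((hasDerivAt_id z).const_sub a).inv (sub_ne_zero.mpr h)
  rwa [neg_neg] at this

/-- The norm condition keeps the segment in a disc that excludes the pole `a`. -/
lemma segmentIntegral_inv_sq {a w : ℂ} (h : ‖w‖ < ‖a‖) :
    segmentIntegral (fun z => 1 / (a - z) ^ 2) w (-w) = (a + w)⁻¹ - (a - w)⁻¹ := by
  have hne : ∀ z ∈ Metric.ball (0 : ℂ) ‖a‖, a ≠ z := by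
    rintro z hz rfl
    simp at hz
  rw [segmentIntegral_eq_sub (F := fun z => (a - z)⁻¹) (convex_ball (0 : ℂ) ‖a‖) (by simpa using h)
    (by simpa using h) (fun z hz => hasDerivAt_inv_const_sub (hne z hz)), sub_neg_eq_add]
  intro z hz
  have := sub_ne_zero.mpr (hne z hz)
  exact ContinuousAt.continuousWithinAt (by fun_prop (disch := simpa using this))

/-! ### Laurent polynomiality on the `w`-line. -/

section KN

variable {ε r : ℂ} (hε : ε ≠ 0) (hr : r ^ 2 = 2 * ε)

lemma curveKN_kernel {w₁ w : ℂ} (h : ‖w‖ < ‖w₁‖) :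
    (curveKN ε r hε hr).kernel 0 w₁ w =
      ((w₁ + w)⁻¹ - (w₁ - w)⁻¹) / ((yKN r (-w) - yKN r w) * w) := by
  have e : deriv (fun w : ℂ => w ^ 2 / 2) w = w := by simp
  simp only [RecursionData.kernel, curveKN]
  rw [segmentIntegral_inv_sq h, e]

/-- The parameter enters only through `1/(pᵢ ± w)`; the denominator of the kernel is one fixed
meromorphic germ. -/
lemma isMero_curveKN_kernel {ι : Type*} (i : ι) :
    IsMero (fun p w => (curveKN ε r hε hr).kernel 0 (p i) w) := by
  have hr0 : r ≠ 0 := by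
    rintro rfl
    exact hε (by simpa using hr.symm)
  have hy := yKN_analyticAt r hr0
  have hy' : AnalyticAt ℂ (fun w => yKN r (-w)) 0 :=
    AnalyticAt.comp (g := yKN r) (f := fun w => -w) (by simpa using hy) (by fun_prop)
  have hm : MeromorphicAt (fun w => ((yKN r (-w) - yKN r w) * w)⁻¹) 0 :=
    ((hy'.sub hy).mul analyticAt_id).meromorphicAt.inv
  have h := ((IsMero.inv_param_sub i (-1)).add ((IsMero.const (-1)).mul
    (IsMero.inv_param_sub i 1))).mul (IsMero.of_meromorphicAt hm)
  refine h.congr fun p hp => ?_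
  filter_upwards [mem_nhdsWithin_of_mem_nhds
    (Metric.ball_mem_nhds (0 : ℂ) (norm_pos_iff.mpr (hp i)))] with w hw
  rw [curveKN_kernel hε hr (by simpa using hw), div_eq_mul_inv]
  ring_nf

/-- For `2g + m > 1` the differential `ω_{g,m+1}` of the curve is a polynomial in the `1 / wᵢ`. -/
def IsLaurentKN (g m : ℕ) : Prop :=
  ∃ q : MvPolynomial (Fin (m + 1)) ℂ, ∀ (w₁ : ℂ) (ws : Fin m → ℂ), w₁ ≠ 0 → (∀ i, ws i ≠ 0) →
    (curveKN ε r hε hr).omegaAux g m w₁ ws =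
      MvPolynomial.eval (fun i => ((Fin.cons w₁ ws : Fin (m + 1) → ℂ) i)⁻¹) q

variable {hε hr}

/-- Used with `c = 1` and `c = -1`, for the arguments `w` and `σ(w)`. Outside the stable range only
the placeholder `0` and `B`, a squared geometric series, occur. -/
lemma IsLaurentKN.isMero_factor {g m : ℕ} (h : 1 < 2 * g + m → IsLaurentKN hε hr g m)
    {ι : Type*} (e : Fin m → ι) {c : ℂ} (hc : c ≠ 0) :
    IsMero (fun p w => (curveKN ε r hε hr).omegaAux g m (c * w) (fun j => p (e j))) := by
  by_cases hst : 1 < 2 * g + m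
  · obtain ⟨q, hq⟩ := h hst
    have hv : ∀ k : Fin (m + 1), IsMero (fun (p : ι → ℂ) w =>
        ((Fin.cons (c * w) (fun j => p (e j)) : Fin (m + 1) → ℂ) k)⁻¹) := by
      intro k
      refine Fin.cases ?_ (fun j => ?_) k
      · simp only [Fin.cons_zero]
        exact IsMero.of_meromorphicAt (by fun_prop)
      · simpa using IsMero.param_inv (e j)
    refine (IsMero.eval_mvPolynomial hv q).congr fun p hp => ?_
    filter_upwards [self_mem_nhdsWithin] with w hw
    exact hq _ _ (mul_ne_zero hc hw) fun i => hp (e i)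
  · have hg : g = 0 := by omega
    subst hg
    have hm : m = 0 ∨ m = 1 := by omega
    rcases hm with rfl | rfl
    · simpa only [RecursionData.omegaAux_zero_zero] using IsMero.const (ι := ι) 0
    · simp only [RecursionData.omegaAux_zero_one]
      have h := (IsMero.inv_param_sub (e 0) c).mul (IsMero.inv_param_sub (e 0) c)
      refine h.congr fun p hp => Filter.Eventually.of_forall fun w => ?_
      simp only [curveKN]
      rw [← mul_inv, one_div, ← sq, show (c * w - p (e 0)) ^ 2 = (p (e 0) - c * w) ^ 2 by ring]

/-- The only unstable case is `B(w, -w) = 1/(2w)²`, which carries no parameter. -/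
lemma IsLaurentKN.isMero_loop {g m : ℕ} (h : 1 < 2 * g + (m + 1) → IsLaurentKN hε hr g (m + 1))
    {ι : Type*} (e : Fin m → ι) :
    IsMero (fun p w => (curveKN ε r hε hr).omegaAux g (m + 1) w
      (Fin.cons (-w) fun j => p (e j))) := by
  by_cases hst : 1 < 2 * g + (m + 1)
  · obtain ⟨q, hq⟩ := h hst
    have hv : ∀ k : Fin (m + 1 + 1), IsMero (fun (p : ι → ℂ) w =>
        ((Fin.cons w (Fin.cons (-w) fun j => p (e j) : Fin (m + 1) → ℂ) :
          Fin (m + 1 + 1) → ℂ) k)⁻¹) := by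
      intro k
      refine Fin.cases ?_ (fun k => Fin.cases ?_ (fun j => ?_) k) k
      · simp only [Fin.cons_zero]
        exact IsMero.of_meromorphicAt (by fun_prop)
      · simp only [Fin.cons_succ, Fin.cons_zero]
        exact IsMero.of_meromorphicAt (by fun_prop)
      · simpa using IsMero.param_inv (e j)
    refine (IsMero.eval_mvPolynomial hv q).congr fun p hp => ?_
    filter_upwards [self_mem_nhdsWithin] with w hw
    refine hq _ _ hw fun i => Fin.cases ?_ (fun j => ?_) i
    · simpa using hw
    · simpa using hp (e j)
  · have hg : g = 0 ∧ m = 0 := by omega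
    obtain ⟨rfl, rfl⟩ := hg
    have hm : MeromorphicAt (fun w : ℂ => 1 / (w - -w) ^ 2) 0 := by fun_prop
    exact (IsMero.of_meromorphicAt hm).congr fun p _ =>
      Filter.Eventually.of_forall fun w => RecursionData.omegaAux_zero_one _ _ _

lemma isMero_integrandKN {g m : ℕ}
    (ih : ∀ g' m', 2 * g' + m' < 2 * g + m → 1 < 2 * g' + m' → IsLaurentKN hε hr g' m') :
    IsMero (fun (p : Fin (m + 1) → ℂ) w =>
      (curveKN ε r hε hr).integrand g m 0 (p 0) (fun j => p j.succ) w) := by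
  unfold RecursionData.integrand
  have hσ : (curveKN ε r hε hr).σ 0 = fun w => -w := rfl
  have hd : ∀ w, deriv ((curveKN ε r hε hr).σ 0) w = -1 := fun w => by rw [hσ]; simp
  simp only [hd]
  refine ((isMero_curveKN_kernel hε hr 0).mul (IsMero.const (-1))).mul (IsMero.add ?_ ?_)
  · split_ifs with hg
    · exact IsLaurentKN.isMero_loop (fun h => ih _ _ (by omega) h) Fin.succ
    · exact IsMero.const 0
  · refine IsMero.sum _ fun P _ => ?_
    have h1 := P.1.isLt
    have h2 := Finset.card_add_card_compl P.2
    simp only [Fintype.card_fin] at h2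
    split_ifs with hP
    · exact IsMero.const 0
    · have hP' : ¬ (P.1.val = 0 ∧ P.2.card = 0) ∧ ¬ (g - P.1.val = 0 ∧ (P.2ᶜ).card = 0) := by
        tauto
      have a := IsLaurentKN.isMero_factor (hε := hε) (hr := hr) (g := P.1.val)
        (fun h => ih _ _ (by omega) h) (fun j => (P.2.orderEmbOfFin rfl j).succ) one_ne_zero
      have b := IsLaurentKN.isMero_factor (hε := hε) (hr := hr) (g := g - P.1.val)
        (fun h => ih _ _ (by omega) h) (fun j => ((P.2ᶜ).orderEmbOfFin rfl j).succ)
        (neg_ne_zero.mpr one_ne_zero)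
      simp only [one_mul, neg_mul] at a b
      exact a.mul b

variable (hε hr)

lemma isLaurentKN (g m : ℕ) (h : 1 < 2 * g + m) : IsLaurentKN hε hr g m := by
  induction hk : 2 * g + m using Nat.strong_induction_on generalizing g m with
  | _ k ih =>
    subst hk
    have hM := isMero_integrandKN (hε := hε) (hr := hr) (g := g) (m := m)
      fun g' m' h1 h2 => ih _ h1 g' m' h2 rfl
    obtain ⟨q, hq⟩ := hM.exists_hasRes
    refine ⟨MvPolynomial.C (1 / 2) * q, fun w₁ ws h1 h2 => ?_⟩
    have hram : (curveKN ε r hε hr).ram = {0} := rfl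
    have hp : ∀ i, (Fin.cons w₁ ws : Fin (m + 1) → ℂ) i ≠ 0 :=
      fun i => Fin.cases (by simpa using h1) (fun j => by simpa using h2 j) i
    -- The coordinate `φ = id` gives the residue that occurs in the recursion.
    have key := (hq _ hp id 0 analyticAt_id rfl (by simp)).residue_eq
    simp only [Fin.cons_zero, Fin.cons_succ, id, deriv_id', mul_one] at key
    rw [RecursionData.omegaAux_stable _ h, hram, Finset.sum_singleton, map_mul,
      MvPolynomial.eval_C, ← key]

/-- The residue of the integrand at `w = 0` can be computed in any local coordinate. -/
lemma hasRes_integrandKN_comp (g m : ℕ) {w₁ : ℂ} {ws : Fin m → ℂ} (h1 : w₁ ≠ 0)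
    (h2 : ∀ i, ws i ≠ 0) {φ : ℂ → ℂ} {ξ : ℂ} (hφ : AnalyticAt ℂ φ ξ) (h0 : φ ξ = 0)
    (hφ' : deriv φ ξ ≠ 0) :
    HasRes (fun z => (curveKN ε r hε hr).integrand g m 0 w₁ ws (φ z) * deriv φ z) ξ
      (residue ((curveKN ε r hε hr).integrand g m 0 w₁ ws) 0) := by
  have hM := isMero_integrandKN (hε := hε) (hr := hr) (g := g) (m := m)
    fun g' m' _ h2 => isLaurentKN hε hr g' m' h2
  obtain ⟨q, hq⟩ := hM.exists_hasRes
  have hp : ∀ i, (Fin.cons w₁ ws : Fin (m + 1) → ℂ) i ≠ 0 :=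
    fun i => Fin.cases (by simpa using h1) (fun j => by simpa using h2 j) i
  have key := (hq _ hp id 0 analyticAt_id rfl (by simp)).residue_eq
  have key2 := hq _ hp φ ξ hφ h0 hφ'
  simp only [Fin.cons_zero, Fin.cons_succ, id, deriv_id', mul_one] at key key2
  rwa [key]

end KN

/-! ### The covering `w = s (z - 1/z)`: branches, bidifferential and kernel. -/

lemma hasDerivAt_mul_sub_inv (s : ℂ) {z : ℂ} (hz : z ≠ 0) :
    HasDerivAt (fun t : ℂ => s * (t - t⁻¹)) (s * (1 + (z ^ 2)⁻¹)) z := by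
  have h : HasDerivAt (fun t : ℂ => s * (t - t⁻¹)) (s * (1 - -(z ^ 2)⁻¹)) z :=
    ((hasDerivAt_id z).sub (hasDerivAt_inv hz)).const_mul s
  rwa [sub_neg_eq_add] at h

lemma csqrt_sq {u : ℂ} (h : 0 < u.re) : csqrt (u ^ 2) = u := by
  rw [csqrt, one_div]
  exact Complex.sq_cpow_two_inv h

/-- With `u = (z - 1/z)/2` one has `1 + u² = ((z + 1/z)/2)²`, and positive real part fixes the root,
so `arcsinh u = log z`. For `r = -2s` the arcsinh becomes `log (1/z) = -log z`, and this sign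
cancels against that of `r`. -/
lemma yKN_pullback {s r z : ℂ} (hs : s ≠ 0) (hr : r = 2 * s ∨ r = -(2 * s)) (hz : z ≠ 0)
    (hre : 0 < ((z + z⁻¹) / 2).re) (hslit : z ∈ Complex.slitPlane) :
    yKN r (s * (z - z⁻¹)) = 2 * Complex.log z / (s * (z + z⁻¹)) := by
  have hsq : ∀ u : ℂ, u ^ 2 = ((z - z⁻¹) / 2) ^ 2 → csqrt (1 + u ^ 2) = (z + z⁻¹) / 2 := by
    intro u hu
    rw [hu, ← csqrt_sq hre]
    congr 1
    field_simp
    ring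
  have harg : z.arg ≠ Real.pi := (Complex.mem_slitPlane_iff_arg.mp hslit).1
  unfold yKN arcsinh
  rcases hr with rfl | rfl
  · have e : s * (z - z⁻¹) / (2 * s) = (z - z⁻¹) / 2 := by field_simp
    rw [e, hsq _ rfl, show (z - z⁻¹) / 2 + (z + z⁻¹) / 2 = z by ring]
    congr 1
    ring
  · have e : s * (z - z⁻¹) / -(2 * s) = -((z - z⁻¹) / 2) := by field_simp
    rw [e, hsq _ (neg_sq _), show -((z - z⁻¹) / 2) + (z + z⁻¹) / 2 = z⁻¹ by ring,
      Complex.log_inv z harg, show -(2 * s) * ((z + z⁻¹) / 2) = -(s * (z + z⁻¹)) by ring, mul_neg,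
      neg_div_neg_eq]

lemma eventually_yKN_pullback_one {s r : ℂ} (hs : s ≠ 0) (hr : r = 2 * s ∨ r = -(2 * s)) :
    ∀ᶠ z in 𝓝 (1 : ℂ), yKN r (s * (z - z⁻¹)) = 2 * Complex.log z / (s * (z + z⁻¹)) := by
  have h1 : ∀ᶠ z in 𝓝 (1 : ℂ), 0 < ((z + z⁻¹) / 2).re := by
    have hc : ContinuousAt (fun z : ℂ => ((z + z⁻¹) / 2).re) 1 :=
      Complex.continuous_re.continuousAt.comp
        ((continuousAt_id.add (continuousAt_inv₀ one_ne_zero)).div_const 2)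
    exact hc.eventually (lt_mem_nhds (by norm_num))
  filter_upwards [h1, Complex.isOpen_slitPlane.mem_nhds Complex.one_mem_slitPlane,
    isOpen_ne.mem_nhds (one_ne_zero (α := ℂ))] with z a b c
  exact yKN_pullback hs hr c a b

lemma eventually_yKN_pullback {s r ξ : ℂ} (hs : s ≠ 0) (hr : r = 2 * s ∨ r = -(2 * s))
    (hξ : ξ = 1 ∨ ξ = -1) :
    ∀ᶠ z in 𝓝 ξ, yKN r (s * (z - z⁻¹)) = 2 * Complex.log (z / ξ) / (s * (z + z⁻¹)) := by
  rcases hξ with rfl | rfl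
  · simpa using eventually_yKN_pullback_one hs hr
  -- The involution `ι` moves `-1` to `1` and fixes `w`; both `log` and `z + 1/z` change sign, so
  -- the quotient is unchanged.
  · have hc : Filter.Tendsto (fun z : ℂ => -z⁻¹) (𝓝 (-1)) (𝓝 1) := by
      have h : ContinuousAt (fun z : ℂ => -z⁻¹) (-1) := (continuousAt_inv₀ (by norm_num)).neg
      have h' := h.tendsto
      norm_num at h'
      exact h'
    have hc' : Filter.Tendsto (fun z : ℂ => -z) (𝓝 (-1)) (𝓝 1) := by
      have h' := (continuous_neg (G := ℂ)).tendsto (-1)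
      rwa [neg_neg] at h'
    filter_upwards [hc.eventually (eventually_yKN_pullback_one hs hr),
      hc'.eventually (Complex.isOpen_slitPlane.mem_nhds Complex.one_mem_slitPlane)] with z h1 h2
    have harg : (-z).arg ≠ Real.pi := (Complex.mem_slitPlane_iff_arg.mp h2).1
    have e : (-z⁻¹)⁻¹ = -z := by rw [inv_neg, inv_inv]
    rw [e, sub_neg_eq_add, neg_add_eq_sub] at h1
    rw [h1, ← inv_neg, Complex.log_inv _ harg, inv_neg,
      show s * (-z⁻¹ + -z) = -(s * (z + z⁻¹)) by ring, mul_neg, neg_div_neg_eq, div_neg, div_one]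

lemma bidifferential_pullback {s z₁ z₂ : ℂ} (hs : s ≠ 0) (h1 : z₁ ≠ 0) (h2 : z₂ ≠ 0)
    (h : z₁ ≠ z₂) (h' : z₁ * z₂ ≠ -1) :
    1 / (s * (z₁ - z₁⁻¹) - s * (z₂ - z₂⁻¹)) ^ 2 *
      (s * (1 + (z₁ ^ 2)⁻¹) * (s * (1 + (z₂ ^ 2)⁻¹))) = spinB z₁ z₂ := by
  have a : z₁ - z₂ ≠ 0 := sub_ne_zero.mpr h
  have b : 1 + z₁ * z₂ ≠ 0 := fun hb => h' (by linear_combination hb)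
  rw [spinB_eq h1, show s * (z₁ - z₁⁻¹) - s * (z₂ - z₂⁻¹) =
    s * (z₁ - z₂) * (1 + z₁ * z₂) / (z₁ * z₂) by field_simp; ring]
  field_simp
  ring

/-- The right side is the pulled-back primitive of `B̃` in the second variable; the left side is its
partial fraction form, which differentiates directly to `spinB z₁`. -/
lemma spinB_primitive {s z₁ z₂ : ℂ} (hs : s ≠ 0) (h1 : z₁ ≠ 0) (h2 : z₂ ≠ 0)
    (h : z₁ ≠ z₂) (h' : 1 + z₁ * z₂ ≠ 0) :
    (z₁ - z₂)⁻¹ - z₁⁻¹ * (1 + z₁ * z₂)⁻¹ =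
      s * (1 + (z₁ ^ 2)⁻¹) * (s * (z₁ - z₁⁻¹) - s * (z₂ - z₂⁻¹))⁻¹ := by
  have a : z₁ - z₂ ≠ 0 := sub_ne_zero.mpr h
  rw [show s * (z₁ - z₁⁻¹) - s * (z₂ - z₂⁻¹) =
    s * (z₁ - z₂) * (1 + z₁ * z₂) / (z₁ * z₂) by field_simp; ring]
  field_simp
  ring

lemma tendsto_one_div_nhds {ξ : ℂ} (hξ : ξ = 1 ∨ ξ = -1) :
    Filter.Tendsto (fun z : ℂ => 1 / z) (𝓝 ξ) (𝓝 ξ) := by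
  have h0 : ξ ≠ 0 := by rcases hξ with rfl | rfl <;> norm_num
  have h1 : 1 / ξ = ξ := by rcases hξ with rfl | rfl <;> norm_num
  have h : ContinuousAt (fun z : ℂ => 1 / z) ξ := continuousAt_const.div continuousAt_id h0
  have := h.tendsto
  rwa [h1] at this

/-- Points near `ξ = ±1` avoid the poles of `B(a, ·)`, for `a` other than `±1`. -/
lemma eventually_ne_and_ne {a ξ : ℂ} (hξ : ξ = 1 ∨ ξ = -1) (h : a ≠ 1 ∧ a ≠ -1) :
    ∀ᶠ z in 𝓝 ξ, a ≠ z ∧ 1 + a * z ≠ 0 := by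
  have h1 : a ≠ ξ ∧ 1 + a * ξ ≠ 0 := by
    rcases hξ with rfl | rfl
    · exact ⟨h.1, fun e => h.2 (by linear_combination e)⟩
    · exact ⟨h.2, fun e => h.1 (by linear_combination -e)⟩
  have hc : ContinuousAt (fun z : ℂ => 1 + a * z) ξ := by fun_prop
  filter_upwards [isOpen_ne.mem_nhds h1.1.symm, hc.eventually_ne h1.2] with z a b
  exact ⟨Ne.symm a, b⟩

lemma eventually_segmentIntegral_spinB {s z₁ ξ : ℂ} (hs : s ≠ 0) (hξ : ξ = 1 ∨ ξ = -1)
    (h0 : z₁ ≠ 0) (h : z₁ ≠ 1 ∧ z₁ ≠ -1) :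
    ∀ᶠ z in 𝓝 ξ, segmentIntegral (spinB z₁) z (1 / z) = s * (1 + (z₁ ^ 2)⁻¹) *
      ((s * (z₁ - z₁⁻¹) + s * (z - z⁻¹))⁻¹ - (s * (z₁ - z₁⁻¹) - s * (z - z⁻¹))⁻¹) := by
  have hξ0 : ξ ≠ 0 := by rcases hξ with rfl | rfl <;> norm_num
  obtain ⟨δ, hδ, hball⟩ := Metric.eventually_nhds_iff_ball.mp (eventually_ne_and_ne hξ h)
  have hB := Metric.ball_mem_nhds ξ hδ
  filter_upwards [hB, (tendsto_one_div_nhds hξ).eventually hB, isOpen_ne.mem_nhds hξ0] with z hz hz' hz0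
  have hz0' : z ≠ 0 := hz0
  have hd : ∀ u ∈ Metric.ball ξ δ, HasDerivAt
      (fun u => (z₁ - u)⁻¹ - z₁⁻¹ * (1 + z₁ * u)⁻¹) (spinB z₁ u) u := by
    intro u hu
    obtain ⟨a, b⟩ := hball u hu
    have h1 := hasDerivAt_inv_const_sub a
    have h2 : HasDerivAt (fun u => z₁⁻¹ * (1 + z₁ * u)⁻¹)
        (z₁⁻¹ * (-(z₁ * 1) / (1 + z₁ * u) ^ 2)) u :=
      ((((hasDerivAt_id u).const_mul z₁).const_add 1).inv b).const_mul z₁⁻¹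
    have e : spinB z₁ u = 1 / (z₁ - u) ^ 2 - z₁⁻¹ * (-(z₁ * 1) / (1 + z₁ * u) ^ 2) := by
      rw [spinB_eq h0]
      field_simp
      ring
    rw [e]
    exact h1.sub h2
  have hcont : ContinuousOn (spinB z₁) (Metric.ball ξ δ) := by
    intro u hu
    obtain ⟨a, b⟩ := hball u hu
    have a' : (z₁ - u) ^ 2 ≠ 0 := pow_ne_zero 2 (sub_ne_zero.mpr a)
    have b' : (1 + z₁ * u) ^ 2 ≠ 0 := pow_ne_zero 2 b
    rw [show spinB z₁ = fun u => 1 / (z₁ - u) ^ 2 + 1 / (1 + z₁ * u) ^ 2 from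
      funext fun u => spinB_eq h0]
    exact ContinuousAt.continuousWithinAt (by fun_prop (disch := assumption))
  rw [segmentIntegral_eq_sub (convex_ball ξ δ) hz hz' hd hcont,
    spinB_primitive hs h0 hz0' (hball z hz).1 (hball z hz).2,
    spinB_primitive hs h0 (one_div_ne_zero hz0') (hball _ hz').1 (hball _ hz').2, ← mul_sub]
  congr 3
  simp only [one_div, inv_inv]
  ring

lemma sqrt_ne_zero {ε s : ℂ} (hε : ε ≠ 0) (hs : s ^ 2 = ε / 2) : s ≠ 0 := by
  rintro rfl
  exact hε (by simpa using hs.symm)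

lemma sqrt_two_mul_eq {ε s r : ℂ} (hs : s ^ 2 = ε / 2) (hr : r ^ 2 = 2 * ε) :
    r = 2 * s ∨ r = -(2 * s) :=
  sq_eq_sq_iff_eq_or_eq_neg.mp (by rw [hr, mul_pow, hs]; ring)

lemma mul_sub_inv_ne_zero {s z : ℂ} (hs : s ≠ 0) (h0 : z ≠ 0) (h : z ≠ 1 ∧ z ≠ -1) :
    s * (z - z⁻¹) ≠ 0 := by
  refine mul_ne_zero hs fun e => ?_
  field_simp at e
  have : (z - 1) * (z + 1) = 0 := by linear_combination e
  rcases mul_eq_zero.mp this with e | e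
  · exact h.1 (sub_eq_zero.mp e)
  · exact h.2 (eq_neg_of_add_eq_zero_left e)

section Spin

variable {ε s r : ℂ} (hε : ε ≠ 0) (hs : s ^ 2 = ε / 2) (hr : r ^ 2 = 2 * ε)

/-- The kernel is a coefficient of `dz₁ / dz`, hence the factor `w'(z₁) / w'(z)`. -/
lemma eventually_kernel_eq {z₁ ξ : ℂ} (hξ : ξ = 1 ∨ ξ = -1) (h0 : z₁ ≠ 0)
    (h : z₁ ≠ 1 ∧ z₁ ≠ -1) :
    ∀ᶠ z in 𝓝 ξ, (curveSpin ε s hε hs).kernel ξ z₁ z =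
      s * (1 + (z₁ ^ 2)⁻¹) *
        (curveKN ε r hε hr).kernel 0 (s * (z₁ - z₁⁻¹)) (s * (z - z⁻¹)) / (s * (1 + (z ^ 2)⁻¹)) := by
  have hs0 := sqrt_ne_zero hε hs
  have hξ0 : ξ ≠ 0 := by rcases hξ with rfl | rfl <;> norm_num
  have hw1 := mul_sub_inv_ne_zero hs0 h0 h
  have hw : ContinuousAt (fun z : ℂ => ‖s * (z - z⁻¹)‖) ξ :=
    (hasDerivAt_mul_sub_inv s hξ0).continuousAt.norm
  have hlt : ∀ᶠ z in 𝓝 ξ, ‖s * (z - z⁻¹)‖ < ‖s * (z₁ - z₁⁻¹)‖ := by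
    refine hw.eventually (gt_mem_nhds ?_)
    have : ξ - ξ⁻¹ = 0 := by rcases hξ with rfl | rfl <;> norm_num
    simpa only [this, mul_zero, norm_zero] using norm_pos_iff.mpr hw1
  have hi : ∀ᶠ z in 𝓝 ξ, 1 + z ^ 2 ≠ 0 := by
    have hc : ContinuousAt (fun z : ℂ => 1 + z ^ 2) ξ := by fun_prop
    refine hc.eventually_ne ?_
    rcases hξ with rfl | rfl <;> norm_num
  have hy := eventually_yKN_pullback hs0 (sqrt_two_mul_eq hs hr) hξ
  filter_upwards [eventually_segmentIntegral_spinB hs0 hξ h0 h, hlt, hi, hy,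
    (tendsto_one_div_nhds hξ).eventually hy, isOpen_ne.mem_nhds hξ0] with z e1 e2 e3 e4 e5 hz
  have hz' : z ≠ 0 := hz
  have hneg : s * (1 / z - (1 / z)⁻¹) = -(s * (z - z⁻¹)) := by
    simp only [one_div, inv_inv]; ring
  rw [hneg] at e5
  rw [curveKN_kernel hε hr e2, e4, e5]
  simp only [RecursionData.kernel, curveSpin]
  rw [e1, (deriv_spin_x s hz').deriv]
  have e6 : s * (1 / z + (1 / z)⁻¹) = s * (z + z⁻¹) := by
    simp only [one_div, inv_inv]; ring
  -- The constant `log ξ` cancels in the difference, and `(1 - z⁻²)(z + z⁻¹) = (z - z⁻¹)(1 + z⁻²)`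
  -- is the identity `x dx = w dw`.
  have e7 : (2 * (Complex.log (1 / z / ξ) + Complex.log ξ) -
        2 * (Complex.log (z / ξ) + Complex.log ξ)) * (s * (1 - 1 / z ^ 2)) =
      (2 * Complex.log (1 / z / ξ) / (s * (1 / z + (1 / z)⁻¹)) -
        2 * Complex.log (z / ξ) / (s * (z + z⁻¹))) * (s * (z - z⁻¹)) *
        (s * (1 + (z ^ 2)⁻¹)) := by
    rw [e6]
    have e3' : z ^ 2 + 1 ≠ 0 := by rwa [add_comm]
    field_simp
    ring
  have hdiv : ∀ a b c d : ℂ, a * b / (c * d) = a * (b / c) / d := fun a b c d => by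
    rw [← mul_div_assoc, div_div]
  rw [e7]
  exact hdiv _ _ _ _

end Spin

/-! ### The induction comparing the two recursions. -/

lemma prod_orderEmbOfFin {n : ℕ} (S : Finset (Fin n)) (f : Fin n → ℂ) :
    ∏ j, f (S.orderEmbOfFin rfl j) = ∏ i ∈ S, f i := by
  conv_rhs => rw [← Finset.map_orderEmbOfFin_univ S rfl, Finset.prod_map]
  rfl

section Pullback

variable {ε s r : ℂ} (hε : ε ≠ 0) (hs : s ^ 2 = ε / 2) (hr : r ^ 2 = 2 * ε)

/-- The coefficient form of `ω_{g,m+1}(z) = 2^{2g-1+m} ω̃_{g,m+1}(w)`, `w = s (z - 1/z)`. -/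
def PullbackEq (g m : ℕ) (z₁ : ℂ) (zs : Fin m → ℂ) : Prop :=
  (curveSpin ε s hε hs).omegaAux g m z₁ zs = (2 : ℂ) ^ (2 * (g : ℤ) - 1 + m) *
    ((curveKN ε r hε hr).omegaAux g m (s * (z₁ - z₁⁻¹)) (fun i => s * (zs i - (zs i)⁻¹)) *
      (s * (1 + (z₁ ^ 2)⁻¹) * ∏ i, s * (1 + (zs i ^ 2)⁻¹)))

/-- `PullbackEq` at all points of the common domain of definition. -/
def PullbackHolds (g m : ℕ) : Prop :=
  ∀ (z₁ : ℂ) (zs : Fin m → ℂ), (z₁ ≠ 0 ∧ z₁ ≠ 1 ∧ z₁ ≠ -1) →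
    (∀ i, zs i ≠ 0 ∧ zs i ≠ 1 ∧ zs i ≠ -1) →
    (2 * g + m = 1 → ∀ i, zs i ≠ z₁ ∧ 1 + zs i * z₁ ≠ 0) → PullbackEq hε hs hr g m z₁ zs

lemma pullbackEq_zero_one {z₁ : ℂ} {zs : Fin 1 → ℂ} (h1 : z₁ ≠ 0) (h2 : zs 0 ≠ 0)
    (h : zs 0 ≠ z₁) (h' : 1 + zs 0 * z₁ ≠ 0) : PullbackEq hε hs hr 0 1 z₁ zs := by
  have key := bidifferential_pullback (sqrt_ne_zero hε hs) h1 h2 h.symm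
    fun e => h' (by linear_combination e)
  unfold PullbackEq
  rw [RecursionData.omegaAux_zero_one, RecursionData.omegaAux_zero_one, Fin.prod_univ_one]
  simpa [curveSpin, curveKN] using key.symm

variable {hε hs hr}

/-- The exponent `2g - 1 + m` of the induction hypothesis becomes `2g - 2 + m` both for the loop
term `(g-1, m+1)` and, by addition, for every splitting of `(g, m)`. -/
lemma PullbackHolds.eventually_integrand_eq {g m : ℕ}
    (ih : ∀ g' m', 2 * g' + m' < 2 * g + m → PullbackHolds hε hs hr g' m')
    {z₁ ξ : ℂ} {zs : Fin m → ℂ} (hξ : ξ = 1 ∨ ξ = -1)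
    (h1 : z₁ ≠ 0 ∧ z₁ ≠ 1 ∧ z₁ ≠ -1) (h2 : ∀ i, zs i ≠ 0 ∧ zs i ≠ 1 ∧ zs i ≠ -1) :
    ∀ᶠ z in 𝓝[≠] ξ, (curveSpin ε s hε hs).integrand g m ξ z₁ zs z =
      (2 : ℂ) ^ (2 * (g : ℤ) - 2 + m) * (s * (1 + (z₁ ^ 2)⁻¹) * ∏ i, s * (1 + (zs i ^ 2)⁻¹)) *
        ((curveKN ε r hε hr).integrand g m 0 (s * (z₁ - z₁⁻¹)) (fun i => s * (zs i - (zs i)⁻¹))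
          (s * (z - z⁻¹)) * deriv (fun t : ℂ => s * (t - t⁻¹)) z) := by
  have hs0 := sqrt_ne_zero hε hs
  have hpt : ∀ᶠ z in 𝓝 ξ, ∀ i, zs i ≠ z ∧ 1 + zs i * z ≠ 0 :=
    Filter.eventually_all.mpr fun i => eventually_ne_and_ne hξ (h2 i).2
  have hgood : ∀ᶠ z in 𝓝 ξ, z ≠ 0 ∧ z ≠ -ξ ∧ 1 + z ^ 2 ≠ 0 := by
    have h0 : ξ ≠ 0 ∧ ξ ≠ -ξ ∧ 1 + ξ ^ 2 ≠ 0 := by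
      rcases hξ with rfl | rfl <;> norm_num [Complex.ext_iff]
    have hc : ContinuousAt (fun z : ℂ => 1 + z ^ 2) ξ := by fun_prop
    filter_upwards [isOpen_ne.mem_nhds h0.1, isOpen_ne.mem_nhds h0.2.1,
      hc.eventually_ne h0.2.2] with z a b c
    exact ⟨a, b, c⟩
  have near {p : ℂ → Prop} (h : ∀ᶠ z in 𝓝 ξ, p z) : ∀ᶠ z in 𝓝[≠] ξ, p z :=
    h.filter_mono nhdsWithin_le_nhds
  filter_upwards [near (eventually_kernel_eq hε hs hr hξ h1.1 h1.2), near hgood, near hpt,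
    near ((tendsto_one_div_nhds hξ).eventually hpt), self_mem_nhdsWithin] with z hK hz hp hp' hne
  obtain ⟨hz0, hz1, hz2⟩ := hz
  have hzz : z ≠ 0 ∧ z ≠ 1 ∧ z ≠ -1 := by
    have hne' : z ≠ ξ := hne
    rcases hξ with rfl | rfl
    · exact ⟨hz0, hne', hz1⟩
    · exact ⟨hz0, by simpa using hz1, hne'⟩
  have hzi : 1 / z ≠ 0 ∧ 1 / z ≠ 1 ∧ 1 / z ≠ -1 := by
    refine ⟨one_div_ne_zero hz0, fun e => hzz.2.1 ?_, fun e => hzz.2.2 ?_⟩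
    · rw [div_eq_iff hz0] at e
      linear_combination -e
    · rw [div_eq_iff hz0] at e
      linear_combination e
  have hneg : s * (1 / z - (1 / z)⁻¹) = -(s * (z - z⁻¹)) := by
    simp only [one_div, inv_inv]; ring
  have hσ : (curveSpin ε s hε hs).σ ξ = fun z => 1 / z := rfl
  have hσd : deriv (fun z : ℂ => 1 / z) z = -(z ^ 2)⁻¹ := by simp
  have hτ : (curveKN ε r hε hr).σ 0 = fun w => -w := rfl
  have hτd : deriv (fun w : ℂ => -w) (s * (z - z⁻¹)) = -1 := by simp
  unfold RecursionData.integrand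
  simp only [hσ, hσd, hτ, hτd, hK, (hasDerivAt_mul_sub_inv s hz0).deriv]
  have hloop : (if 0 < g then
        (curveSpin ε s hε hs).omegaAux (g - 1) (m + 1) z (Fin.cons (1 / z) zs) else 0) =
      (2 : ℂ) ^ (2 * (g : ℤ) - 2 + m) * (s * (1 + (z ^ 2)⁻¹) * (s * (1 + ((1 / z) ^ 2)⁻¹)) *
        ∏ i, s * (1 + (zs i ^ 2)⁻¹)) *
      (if 0 < g then (curveKN ε r hε hr).omegaAux (g - 1) (m + 1) (s * (z - z⁻¹))
        (Fin.cons (-(s * (z - z⁻¹))) fun i => s * (zs i - (zs i)⁻¹)) else 0) := by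
    split_ifs with hg
    · have h := ih (g - 1) (m + 1) (by omega) z (Fin.cons (1 / z) zs) hzz
        (fun i => Fin.cases (by simpa using hzi) (fun j => by simpa using h2 j) i) ?_
      · have hc : (fun i => s * ((Fin.cons (1 / z) zs : Fin (m + 1) → ℂ) i -
            ((Fin.cons (1 / z) zs : Fin (m + 1) → ℂ) i)⁻¹)) =
            Fin.cons (-(s * (z - z⁻¹))) fun i => s * (zs i - (zs i)⁻¹) := by
          funext i
          refine Fin.cases ?_ (fun j => ?_) i
          · simpa only [Fin.cons_zero] using hneg
          · simp only [Fin.cons_succ]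
        unfold PullbackEq at h
        rw [h, hc, Fin.prod_univ_succ]
        simp only [Fin.cons_zero, Fin.cons_succ]
        rw [show 2 * ((g - 1 : ℕ) : ℤ) - 1 + ((m + 1 : ℕ) : ℤ) = 2 * (g : ℤ) - 2 + m by
          push_cast [Nat.cast_sub hg]; ring]
        ring
      -- The loop term is `B(z, 1/z)` when `(g, m) = (1, 0)`. Its poles are avoided because `z ≠ ±1`
      -- and `1 + (1/z) z = 2`.
      · intro hgm i
        have hm : m = 0 := by omega
        subst hm
        obtain rfl : i = 0 := Fin.fin_one_eq_zero i
        simp only [Fin.cons_zero]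
        refine ⟨fun e => ?_, ?_⟩
        · rw [div_eq_iff hz0] at e
          have : (z - 1) * (z + 1) = 0 := by linear_combination -e
          rcases mul_eq_zero.mp this with e | e
          · exact hzz.2.1 (sub_eq_zero.mp e)
          · exact hzz.2.2 (eq_neg_of_add_eq_zero_left e)
        · rw [one_div, inv_mul_cancel₀ hz0]
          norm_num
    · simp
  have hsplit : ∀ P : Fin (g + 1) × Finset (Fin m),
      (if (P.1.val = 0 ∧ P.2.card = 0) ∨ (g - P.1.val = 0 ∧ (P.2ᶜ).card = 0) then 0
        else
          (curveSpin ε s hε hs).omegaAux P.1.val P.2.card z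
              (fun j => zs (P.2.orderEmbOfFin rfl j)) *
            (curveSpin ε s hε hs).omegaAux (g - P.1.val) (P.2ᶜ).card (1 / z)
              (fun j => zs ((P.2ᶜ).orderEmbOfFin rfl j))) =
      (2 : ℂ) ^ (2 * (g : ℤ) - 2 + m) * (s * (1 + (z ^ 2)⁻¹) * (s * (1 + ((1 / z) ^ 2)⁻¹)) *
        ∏ i, s * (1 + (zs i ^ 2)⁻¹)) *
      (if (P.1.val = 0 ∧ P.2.card = 0) ∨ (g - P.1.val = 0 ∧ (P.2ᶜ).card = 0) then 0
        else
          (curveKN ε r hε hr).omegaAux P.1.val P.2.card (s * (z - z⁻¹))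
              (fun j => s * (zs (P.2.orderEmbOfFin rfl j) - (zs (P.2.orderEmbOfFin rfl j))⁻¹)) *
            (curveKN ε r hε hr).omegaAux (g - P.1.val) (P.2ᶜ).card (-(s * (z - z⁻¹)))
              (fun j => s * (zs ((P.2ᶜ).orderEmbOfFin rfl j) -
                (zs ((P.2ᶜ).orderEmbOfFin rfl j))⁻¹))) := by
    intro P
    have b1 := P.1.isLt
    have b2 := Finset.card_add_card_compl P.2
    simp only [Fintype.card_fin] at b2
    split_ifs with hP
    · simp
    · have hP' : ¬ (P.1.val = 0 ∧ P.2.card = 0) ∧ ¬ (g - P.1.val = 0 ∧ (P.2ᶜ).card = 0) := by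
        tauto
      have e1 := ih P.1.val P.2.card (by omega) z (fun j => zs (P.2.orderEmbOfFin rfl j)) hzz
        (fun i => h2 _) (fun _ i => hp _)
      have e2 := ih (g - P.1.val) (P.2ᶜ).card (by omega) (1 / z)
        (fun j => zs ((P.2ᶜ).orderEmbOfFin rfl j)) hzi (fun i => h2 _) (fun _ i => hp' _)
      have hpow : (2 : ℂ) ^ (2 * (g : ℤ) - 2 + m) = 2 ^ (2 * (P.1.val : ℤ) - 1 + (P.2.card : ℤ)) *
          2 ^ (2 * ((g - P.1.val : ℕ) : ℤ) - 1 + ((P.2ᶜ).card : ℤ)) := by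
        rw [← zpow_add₀ (two_ne_zero (α := ℂ))]
        congr 1
        omega
      unfold PullbackEq at e1 e2
      rw [e1, e2, hneg, prod_orderEmbOfFin P.2 (fun i => s * (1 + (zs i ^ 2)⁻¹)),
        prod_orderEmbOfFin P.2ᶜ (fun i => s * (1 + (zs i ^ 2)⁻¹)),
        ← Finset.prod_mul_prod_compl P.2 (fun i => s * (1 + (zs i ^ 2)⁻¹)),
        hpow]
      ring
  rw [hloop, Finset.sum_congr rfl fun P _ => hsplit P, ← Finset.mul_sum, ← mul_add]
  have hW : s * (1 + (z ^ 2)⁻¹) ≠ 0 := by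
    refine mul_ne_zero hs0 fun e => hz2 ?_
    field_simp at e
    linear_combination e
  -- This is the derivative of `w(1/z) = -w(z)`.
  have hW' : -(z ^ 2)⁻¹ * (s * (1 + ((1 / z) ^ 2)⁻¹)) = -(s * (1 + (z ^ 2)⁻¹)) := by
    field_simp
    ring
  -- Bookkeeping of Jacobians: the kernel brings `1/W`, the two inner arguments bring `W i`, and `d
  -- i = -W`. What survives is one `W` for the pulled-back `dw` and the `-1` that is the derivative
  -- of `w ↦ -w`.
  have alg : ∀ c k W A i d p S : ℂ, W ≠ 0 → d * i = -W →
      c * k / W * d * (p * (W * i * A) * S) = p * (c * A) * (k * -1 * S * W) := by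
    intro c k W A i d p S hW h
    field_simp
    linear_combination (c * k * p * A * S) * h
  exact alg _ _ _ _ _ _ _ _ hW hW'

variable (hε hs hr)

lemma pullbackHolds (g m : ℕ) : PullbackHolds hε hs hr g m := by
  induction hk : 2 * g + m using Nat.strong_induction_on generalizing g m with
  | _ k ih =>
    subst hk
    intro z₁ zs h1 h2 h3
    by_cases hst : 1 < 2 * g + m
    · have hs0 := sqrt_ne_zero hε hs
      have hw1 := mul_sub_inv_ne_zero hs0 h1.1 h1.2
      have hw2 := fun i => mul_sub_inv_ne_zero hs0 (h2 i).1 (h2 i).2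
      have hres : ∀ ξ : ℂ, ξ = 1 ∨ ξ = -1 →
          residue ((curveSpin ε s hε hs).integrand g m ξ z₁ zs) ξ =
            (2 : ℂ) ^ (2 * (g : ℤ) - 2 + m) *
              (s * (1 + (z₁ ^ 2)⁻¹) * ∏ i, s * (1 + (zs i ^ 2)⁻¹)) *
              residue ((curveKN ε r hε hr).integrand g m 0 (s * (z₁ - z₁⁻¹))
                (fun i => s * (zs i - (zs i)⁻¹))) 0 := by
        intro ξ hξ
        have hξ0 : ξ ≠ 0 := by rcases hξ with rfl | rfl <;> norm_num
        have han : AnalyticAt ℂ (fun t : ℂ => s * (t - t⁻¹)) ξ :=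
          analyticAt_const.mul (analyticAt_id.sub (analyticAt_inv hξ0))
        have hd : deriv (fun t : ℂ => s * (t - t⁻¹)) ξ ≠ 0 := by
          rw [(hasDerivAt_mul_sub_inv s hξ0).deriv]
          refine mul_ne_zero hs0 ?_
          rcases hξ with rfl | rfl <;> norm_num
        have hR := hasRes_integrandKN_comp hε hr g m hw1 hw2 han
          (by rcases hξ with rfl | rfl <;> norm_num) hd
        exact ((hR.const_mul _).congr (PullbackHolds.eventually_integrand_eq
          (fun g' m' h => ih _ h g' m' rfl) hξ h1 h2)).residue_eq
      have hram : (curveSpin ε s hε hs).ram = {1, -1} := rfl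
      have hram' : (curveKN ε r hε hr).ram = {0} := rfl
      unfold PullbackEq
      -- Two equal residues upstairs against one downstairs raise the exponent by one.
      rw [RecursionData.omegaAux_stable _ hst, RecursionData.omegaAux_stable _ hst, hram, hram',
        Finset.sum_pair (by norm_num [Complex.ext_iff]), Finset.sum_singleton,
        hres 1 (Or.inl rfl), hres (-1) (Or.inr rfl),
        show 2 * (g : ℤ) - 1 + m = (2 * (g : ℤ) - 2 + m) + 1 by ring,
        zpow_add_one₀ (two_ne_zero (α := ℂ))]
      ring
    · have hg : g = 0 := by omega
      subst hg
      have hm : m = 0 ∨ m = 1 := by omega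
      rcases hm with rfl | rfl
      · simp [PullbackEq, RecursionData.omegaAux_zero_zero]
      · exact pullbackEq_zero_one hε hs hr h1.1 (h2 0).1 (h3 rfl 0).1 (h3 rfl 0).2

end Pullback

end TopRec

end

/-! ### The three ranges of `(g, n)`. -/

theorem mainTheorem7 (ε s r : ℂ) (hε : ε ≠ 0) (hs : s ^ 2 = ε / 2) (hr : r ^ 2 = 2 * ε) :
    -- the stable range `2g - 2 + n > 0`
    (∀ g n : ℕ, 1 ≤ n → 2 < 2 * g + n → ∀ z : Fin n → ℂ, (∀ i, z i ≠ 0 ∧ z i ≠ 1 ∧ z i ≠ -1) →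
      (2 : ℂ) ^ (2 * (g : ℤ) - 2 + n) *
          ((TopRec.curveKN ε r hε hr).omega g n (fun i => s * (z i - (z i)⁻¹)) *
            ∏ i, deriv (fun t : ℂ => s * (t - t⁻¹)) (z i)) =
        (TopRec.curveSpin ε s hε hs).omega g n z) ∧
    -- `(g, n) = (0, 2)`, away from the poles `z₁ = z₂` and `z₁ = -1/z₂`
    (∀ z : Fin 2 → ℂ, (∀ i, z i ≠ 0) → z 0 ≠ z 1 → z 0 * z 1 ≠ -1 →
      (2 : ℂ) ^ (2 * ((0 : ℕ) : ℤ) - 2 + (2 : ℕ)) *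
          ((TopRec.curveKN ε r hε hr).omega 0 2 (fun i => s * (z i - (z i)⁻¹)) *
            ∏ i, deriv (fun t : ℂ => s * (t - t⁻¹)) (z i)) =
        (TopRec.curveSpin ε s hε hs).omega 0 2 z) ∧
    -- `(g, n) = (0, 1)`, in the branches near `w = 0` and `z = 1`
    (∀ᶠ z in nhds (1 : ℂ),
      (2 : ℂ) ^ (2 * ((0 : ℕ) : ℤ) - 2 + (1 : ℕ)) *
          ((TopRec.curveKN ε r hε hr).omega01 0 (s * (z - z⁻¹)) *
            deriv (fun t : ℂ => s * (t - t⁻¹)) z) =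
        (TopRec.curveSpin ε s hε hs).omega01 1 z) := by
  have main : ∀ (g m : ℕ) (z : Fin (m + 1) → ℂ), (∀ i, z i ≠ 0) →
      TopRec.PullbackEq hε hs hr g m (z 0) (Fin.tail z) →
      (2 : ℂ) ^ (2 * (g : ℤ) - 2 + (m + 1 : ℕ)) *
          ((TopRec.curveKN ε r hε hr).omega g (m + 1) (fun i => s * (z i - (z i)⁻¹)) *
            ∏ i, deriv (fun t : ℂ => s * (t - t⁻¹)) (z i)) =
        (TopRec.curveSpin ε s hε hs).omega g (m + 1) z := by
    intro g m z hz h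
    unfold TopRec.PullbackEq at h
    have he : 2 * (g : ℤ) - 2 + ((m + 1 : ℕ) : ℤ) = 2 * (g : ℤ) - 1 + m := by push_cast; ring
    rw [he, Fin.prod_univ_succ, (TopRec.hasDerivAt_mul_sub_inv s (hz 0)).deriv,
      Finset.prod_congr rfl fun i _ => (TopRec.hasDerivAt_mul_sub_inv s (hz (Fin.succ i))).deriv]
    exact h.symm
  refine ⟨fun g n hn hgn z hz => ?_, fun z hz h h' => ?_, ?_⟩
  · obtain ⟨m, rfl⟩ : ∃ m, n = m + 1 := ⟨n - 1, by omega⟩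
    exact main g m z (fun i => (hz i).1) (TopRec.pullbackHolds hε hs hr g m (z 0) (Fin.tail z)
      (hz 0) (fun i => hz i.succ) (fun e => by omega))
  · exact main 0 1 z hz (TopRec.pullbackEq_zero_one hε hs hr (hz 0) (hz 1) h.symm
      fun (e : 1 + z 1 * z 0 = 0) => h' (by linear_combination e))
  · have hs0 := TopRec.sqrt_ne_zero hε hs
    have hc : ContinuousAt (fun z : ℂ => z ^ 2 + 1) 1 := by fun_prop
    filter_upwards [TopRec.eventually_yKN_pullback_one hs0 (TopRec.sqrt_two_mul_eq hs hr),
      isOpen_ne.mem_nhds (one_ne_zero (α := ℂ)), hc.eventually_ne (y := 0) (by norm_num)] with z h1 h2 h3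
    have hz : z ≠ 0 := h2
    have hx : deriv (fun w : ℂ => w ^ 2 / 2) (s * (z - z⁻¹)) = s * (z - z⁻¹) := by simp
    simp only [TopRec.SpectralCurve.omega01, TopRec.EquivariantSpectralCurve.omega01,
      TopRec.curveKN, TopRec.curveSpin]
    -- The order of the group `ℤˣ` is `2`, so its inverse matches the power `2^(-1)`.
    rw [h1, hx, (TopRec.hasDerivAt_mul_sub_inv s hz).deriv, (TopRec.deriv_spin_x s hz).deriv]
    simp only [div_one, Complex.log_one, add_zero, Fintype.card_units_int]
    norm_num
    field_simp
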